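/- **Conventions.** A tempered distribution $u\in\mathcal S'(\mathbb R)$ is *bounded* if $u*\varphi\in L^\infty$ for every Schwartz function $\varphi$. Let $P_t(x)=\frac1\pi\frac{t}{t^2+x^2}$ $(t>0)$. For bounded $u$ the convolution $P_t*u$ is a bounded continuous function. The Hardy space $H^1(\mathbb R)$ consists of the bounded $u\in\mathcal S'(\mathbb R)$ for which $M_Pu(x)=\sup_{t>0}|(P_t*u)(x)|$ is integrable, with $\|u\|_{H^1}=\|M_Pu\|_{L^1}$. Each $u\in H^1$ is (given by) an integrable function, unique almost everywhere; this inclusion $H^1\subset L^1$ is what gives meaning to the operator below on $H^1$. For real $a_k,b_k$ and $A_k,B_k>0$ with $\sum_{k=1}^mA_k=\sum_{k=1}^mB_k$ put $R=\prod_{k=1}^m A_k^{-A_k}\prod_{k=1}^m B_k^{B_k}$ and, for $0<z<R$, $$H^{m,0}_{m,m}\left[z\left|\begin{matrix}(a_k,A_k)_{1,m}\\(b_k,B_k)_{1,m}\end{matrix}\right.\right]=\frac1{2\pi i}\int_{L}\prod_{k=1}^m\frac{\Gamma(B_ks+b_k)}{\Gamma(A_ks+a_k)}\,z^{-s}\,ds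 ,$$ where $L$ is a left loop that starts at $-\infty+i\varphi_1$, runs along $\operatorname{Im}s=\varphi_1$ to $c+i\varphi_1$, then vertically to $c+i\varphi_2$, and returns along $\operatorname{Im}s=\varphi_2$ to $-\infty+i\varphi_2$, with $\varphi_1<0<\varphi_2$ and $c>\max_k(-b_k/B_k)$, so that it encircles all poles of the $\Gamma(B_ks+b_k)$. For $z\ge R$ the function is taken to be $0$ (for $z>R$ this is its value along the usual right loop, which encircles no pole). **Theorem.** Let $m\ge1$ and, for $k=1,\dots,m$, let $\beta_k,\lambda_k>0$, $\delta_k\ge0$, $\gamma_k\in\mathbb R$ satisfy 1. $\sum_{k=1}^m\frac1{\lambda_k}=\sum_{k=1}^m\frac1{\beta_k}$; 2. $\sum_{k=1}^m\delta_k>0$; 3. $\min_{1\le k\le m}(\gamma_k+1)\lambda_k>1$. Write $$h(\sigma)=H^{m,0}_{m,m}\left[\sigma\left|\begin{matrix}(\gamma_k+\delta_k+1-1/\beta_k,\,1/\beta_k)_{1,m}\\(\gamma_k+1-1/\lambda_k,\,1/\lambda_k)_{1,m}\end{matrix}\right.\right],\qquad 0<\sigma<1 ,$$ with any left loop $L$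 as above. Then $$\mathsf k_1=\int_0^1|h(\sigma)|\,\frac{d\sigma}\sigma<\infty .$$ Moreover every $f\in H^1(\mathbb R)$ is an integrable function, and for every (integrable) representative $f$ the integral $$I^{(\gamma_k),(\delta_k)}_{(\beta_k),(\lambda_k),m}f(x)=\int_0^1h(\sigma)\,f(x\sigma)\,d\sigma$$ converges absolutely for almost every $x\in\mathbb R$, defines an integrable function that belongs to $H^1(\mathbb R)$, and $$\left\|I^{(\gamma_k),(\delta_k)}_{(\beta_k),(\lambda_k),m}f\right\|_{H^1}\le\mathsf k_1\,\|f\|_{H^1}.$$ -/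

import Mathlib

open MeasureTheory Set
open scoped ENNReal SchwartzMap

noncomputable section

/-! ### The Fox function `H^{m,0}_{m,m}` with real parameters -/

/-- The Mellin-Barnes integrand
`∏ₖ Γ(Bₖ s + bₖ) / ∏ₖ Γ(Aₖ s + aₖ) · z^{-s}` of
`H^{m,0}_{m,m}[z | (aₖ, Aₖ)_{1,m}; (bₖ, Bₖ)_{1,m}]`, for `z > 0`. -/
def foxIntegrand {m : ℕ} (a A b B : Fin m → ℝ) (z : ℝ) (s : ℂ) : ℂ :=
  (∏ k, Complex.Gamma ((B k : ℂ) * s + (b k : ℂ))) /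
    (∏ k, Complex.Gamma ((A k : ℂ) * s + (a k : ℂ))) * (z : ℂ) ^ (-s)

/-- A left loop `L_{-∞}` in the horizontal strip `φ₁ ≤ Im s ≤ φ₂`: it comes from `-∞ + iφ₁`
along a horizontal ray up to `c + iφ₁`, goes up to `c + iφ₂` and returns along a horizontal ray
to `-∞ + iφ₂`.  It encircles all the poles `s = -(bₖ + l) / Bₖ` (`l = 0, 1, 2, …`) of the factors
`Γ(Bₖ s + bₖ)`. -/
structure LeftLoop {m : ℕ} (b B : Fin m → ℝ) where
  c : ℝ
  φ₁ : ℝ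
  φ₂ : ℝ
  φ₁_neg : φ₁ < 0
  φ₂_pos : 0 < φ₂
  pole_lt : ∀ k, -(b k) / B k < c

/-- The contour integral `∫_L F(s) ds` along a left loop. -/
def LeftLoop.integral {m : ℕ} {b B : Fin m → ℝ} (L : LeftLoop b B) (F : ℂ → ℂ) : ℂ :=
  (∫ x in Iic L.c, F ((x : ℂ) + (L.φ₁ : ℂ) * Complex.I))
    + Complex.I * (∫ y in L.φ₁..L.φ₂, F ((L.c : ℂ) + (y : ℂ) * Complex.I))
    - ∫ x in Iic L.c, F ((x : ℂ) + (L.φ₂ : ℂ) * Complex.I)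

/-- The number `∏ₖ Aₖ^{-Aₖ} ∏ₖ Bₖ^{Bₖ}`. -/
def foxRadius {m : ℕ} (A B : Fin m → ℝ) : ℝ :=
  (∏ k, A k ^ (-(A k))) * ∏ k, B k ^ (B k)

/-- The Fox function `H^{m,0}_{m,m}[z | (aₖ, Aₖ)_{1,m}; (bₖ, Bₖ)_{1,m}]` for real `z`, in the
balanced case `∑ Aₖ = ∑ Bₖ`.  For `0 < z < foxRadius A B` it is the Mellin-Barnes integral along
the left loop `L`.  For `z > foxRadius A B` the integral along a left loop diverges and the usual
contour is a right loop; as it encircles no poles, the value there is `0`. -/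
def foxH {m : ℕ} (a A b B : Fin m → ℝ) (L : LeftLoop b B) (z : ℝ) : ℂ :=
  if 0 < z ∧ z < foxRadius A B then
    1 / (2 * (Real.pi : ℂ) * Complex.I) * L.integral (foxIntegrand a A b B z)
  else 0

/-! ### The multiple Erdélyi-Kober operator of Galué et al. -/

/-- The kernel
`H^{m,0}_{m,m}[σ | (γₖ + δₖ + 1 - 1/βₖ, 1/βₖ)_{1,m}; (γₖ + 1 - 1/λₖ, 1/λₖ)_{1,m}]`;
here `lam` is `(λₖ)`. -/
def galueKernel {m : ℕ} (β lam γ δ : Fin m → ℝ)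
    (L : LeftLoop (fun k => γ k + 1 - 1 / lam k) (fun k => 1 / lam k)) (σ : ℝ) : ℂ :=
  foxH (fun k => γ k + δ k + 1 - 1 / β k) (fun k => 1 / β k)
    (fun k => γ k + 1 - 1 / lam k) (fun k => 1 / lam k) L σ

/-- The operator `I^{(γₖ),(δₖ)}_{(βₖ),(λₖ),m}` in the case `∑ δₖ > 0`. -/
def galueOperator {m : ℕ} (β lam γ δ : Fin m → ℝ)
    (L : LeftLoop (fun k => γ k + 1 - 1 / lam k) (fun k => 1 / lam k))
    (f : ℝ → ℂ) (x : ℝ) : ℂ :=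
  ∫ σ in Ioo (0 : ℝ) 1, galueKernel β lam γ δ L σ * f (x * σ)

/-- The constant `k₁ = ∫₀¹ |H^{m,0}_{m,m}[σ]| dσ / σ`. -/
def galueConst {m : ℕ} (β lam γ δ : Fin m → ℝ)
    (L : LeftLoop (fun k => γ k + 1 - 1 / lam k) (fun k => 1 / lam k)) : ℝ :=
  ∫ σ in Ioo (0 : ℝ) 1, ‖galueKernel β lam γ δ L σ‖ / σ

/-! ### The Hardy space `H¹(ℝ)` -/

/-- The dilated Poisson kernel `P_t(x) = t⁻¹ P(x / t)`, `P(x) = 1 / (π (1 + x²))`. -/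
def poissonKernelLine (t x : ℝ) : ℝ := t⁻¹ * (1 / Real.pi * (1 / (1 + (x / t) ^ 2)))

/-- A tempered distribution `u` is bounded if `u * φ` is a bounded function for every Schwartz
function `φ`.  As `(u * φ)(x) = u(φ(x - ·))` and `φ` may be replaced by its reflection, this says
that `x ↦ u(φ(· - x))` is bounded for every `φ`. -/
def IsBoundedDistribution (u : 𝓢'(ℝ, ℂ)) : Prop :=
  ∀ φ : 𝓢(ℝ, ℂ), ∃ C : ℝ, ∀ x : ℝ, ‖u (φ.compSubConstCLM ℂ x)‖ ≤ C

/-- `v` is the bounded continuous function that represents the convolution `P_t * u` of the Poisson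
kernel with a bounded tempered distribution `u`, which is defined by duality:
`⟨P_t * u, φ⟩ = ∫ P_t(x) u(φ(· + x)) dx`.  There is at most one such `v`. -/
structure IsPoissonConv (u : 𝓢'(ℝ, ℂ)) (t : ℝ) (v : ℝ → ℂ) : Prop where
  continuous : Continuous v
  bounded : ∃ C : ℝ, ∀ x, ‖v x‖ ≤ C
  pairing : ∀ φ : 𝓢(ℝ, ℂ),
    ∫ y, v y * φ y = ∫ x, (poissonKernelLine t x : ℂ) * u (φ.compSubConstCLM ℂ (-x))

open Classical in
/-- The function `P_t * u`. -/
def poissonConv (u : 𝓢'(ℝ, ℂ)) (t : ℝ) : ℝ → ℂ :=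
  if h : ∃ v, IsPoissonConv u t v then h.choose else 0

/-- The Poisson maximal function `M_P u (x) = sup_{t > 0} |(P_t * u)(x)|`. -/
def poissonMaximal (u : 𝓢'(ℝ, ℂ)) (x : ℝ) : ℝ≥0∞ :=
  ⨆ (t : ℝ) (_ : 0 < t), ‖poissonConv u t x‖ₑ

/-- `‖u‖_{H¹} = ‖M_P u‖_{L¹}`. -/
def hardyNorm (u : 𝓢'(ℝ, ℂ)) : ℝ≥0∞ := ∫⁻ x, poissonMaximal u x

/-- `u ∈ H¹(ℝ)`: `u` is a bounded tempered distribution and its Poisson maximal function is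
integrable.  The field `poisson`, which holds for every bounded tempered distribution, records
that the convolutions `P_t * u` are functions. -/
structure MemHardyH1 (u : 𝓢'(ℝ, ℂ)) : Prop where
  bounded : IsBoundedDistribution u
  poisson : ∀ t : ℝ, 0 < t → ∃ v, IsPoissonConv u t v
  maximal : hardyNorm u < ∞

/-- The tempered distribution `u` is the integrable function `f`. -/
structure IsIntegrableRep (u : 𝓢'(ℝ, ℂ)) (f : ℝ → ℂ) : Prop where
  integrable : Integrable f
  pairing : ∀ φ : 𝓢(ℝ, ℂ), u φ = ∫ x, f x * φ x

end

/-! The operator is an average of dilations. The Poisson integral of f(·σ) at height t and point x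
is that of f at height tσ and point xσ. As tσ is again positive, the maximal function of the image
at x is at most ∫ |h(σ)| M_P f(xσ) dσ. Integrating in x turns each dilation into a factor 1/σ, which
gives exactly the constant k₁ (`exists_memHardyH1_dilation_average`). All else is k₁ < ∞ and the
inclusion H¹ ⊂ L¹.

Finiteness of k₁ (`integrableOn_foxH_div`) needs no asymptotics of h at the ends of its support. The
vertical side of the loop is moved into the left half plane, h(z)/z is written as a contour
integral, and absolute values are integrated over z first: ∫₀^R z^(-Re s - 1) dz = R^(-Re s) / (-Re
s). Stirling's formula and the reflection formula bound the Gamma quotient at x + iφ, as x → -∞, by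
R^x (-x)^(-∑δ). The powers of R cancel and (-x)^(-∑δ - 1) remains, which is integrable because ∑δ >
0.

For H¹ ⊂ L¹, letting t → 0 gives |u(φ)| ≤ ∫ M_P u |φ|. Then u is a bounded functional for the finite
measure M_P u dx, and the Riesz theorem in L² of this measure provides a density
(`exists_isIntegrableRep_of_enorm_apply_le`). -/

open Filter Topology Asymptotics

/-! ### Bounds for the Gamma function -/

/-- A continuous function that does not decrease under unit steps attains its minimum on `[1, ∞)`,
in `[1, 2]`. -/
theorem exists_forall_le_of_le_add_one {f : ℝ → ℝ} (hf : ContinuousOn f (Icc 1 2))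
    (hstep : ∀ x, 1 ≤ x → f x ≤ f (x + 1)) : ∃ x₀ ∈ Icc (1 : ℝ) 2, ∀ x, 1 ≤ x → f x₀ ≤ f x := by
  obtain ⟨x₀, hx₀, hmin⟩ := isCompact_Icc.exists_isMinOn ⟨1, by norm_num⟩ hf
  refine ⟨x₀, hx₀, fun x hx => ?_⟩
  have key : ∀ n : ℕ, ∀ y, y ∈ Icc (1 : ℝ) 2 → f x₀ ≤ f (y + n) := by
    intro n
    induction n with
    | zero => intro y hy; simpa using hmin hy
    | succ n ih =>
      intro y hy
      have h := hstep (y + n) (by have := hy.1; have := n.cast_nonneg (α := ℝ); linarith)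
      push_cast
      rw [← add_assoc]
      exact (ih y hy).trans h
  have h1 : 0 ≤ x - 1 := by linarith
  have := key ⌊x - 1⌋₊ (x - ⌊x - 1⌋₊)
    ⟨by have := Nat.floor_le h1; linarith, by have := Nat.lt_floor_add_one (x - 1); linarith⟩
  simpa using this

theorem Real.continuousOn_Gamma_Icc : ContinuousOn Real.Gamma (Icc 1 2) := fun x hx =>
  (Real.differentiableAt_Gamma fun m => by
    have := hx.1; have := m.cast_nonneg (α := ℝ); intro h; linarith).continuousAt.continuousWithinAt

theorem Real.one_le_add_half_mul_log {x : ℝ} (hx : 0 < x) :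
    1 ≤ (x + 1 / 2) * (Real.log (x + 1) - Real.log x) := by
  have h := Real.le_log_one_add_of_nonneg (x := 1 / x) (by positivity)
  have e : Real.log (1 + 1 / x) = Real.log (x + 1) - Real.log x := by
    rw [← Real.log_div (by positivity) hx.ne']; congr 1; field_simp
  rw [e] at h
  have e2 : 2 * (1 / x) / (1 / x + 2) = 1 / (x + 1 / 2) := by field_simp; ring
  rw [e2, div_le_iff₀ (by positivity)] at h
  linarith

/-- Apply log y ≤ sinh (log y) = (y - 1/y)/2 to y = (x + 1)/x. The excess over 1 is then 1/(4x(x +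
1)), written so that it telescopes under unit steps. -/
theorem Real.add_half_mul_log_le {x : ℝ} (hx : 0 < x) :
    (x + 1 / 2) * (Real.log (x + 1) - Real.log x) ≤ 1 + (1 / (4 * x) - 1 / (4 * (x + 1))) := by
  have e : Real.log ((x + 1) / x) = Real.log (x + 1) - Real.log x :=
    Real.log_div (by positivity) hx.ne'
  have hpos : 0 < (x + 1) / x := by positivity
  have h : Real.log ((x + 1) / x) ≤ Real.sinh (Real.log ((x + 1) / x)) := by
    rw [Real.self_le_sinh_iff]
    exact Real.log_nonneg (by rw [le_div_iff₀ hx]; linarith)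
  rw [Real.sinh_log hpos, e] at h
  calc _ ≤ (x + 1 / 2) * (((x + 1) / x - ((x + 1) / x)⁻¹) / 2) := by gcongr
    _ = _ := by field_simp; ring

/-- **Stirling's formula** for the Gamma function, up to a bounded error in the logarithm. -/
theorem Real.exists_abs_log_Gamma_sub_le :
    ∃ K, ∀ x : ℝ, 1 ≤ x → |Real.log (Real.Gamma x) - ((x - 1 / 2) * Real.log x - x)| ≤ K := by
  set g : ℝ → ℝ := fun x => Real.log (Real.Gamma x) - ((x - 1 / 2) * Real.log x - x) with hg
  have hcont : ContinuousOn g (Icc 1 2) := by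
    refine (Real.continuousOn_Gamma_Icc.log fun x hx => ?_).sub
      (((continuousOn_id.sub continuousOn_const).mul (continuousOn_id.log fun x hx => ?_)).sub
        continuousOn_id)
    · exact (Real.Gamma_pos_of_pos (by linarith [hx.1])).ne'
    · simp only [id]; linarith [hx.1]
  have hstep : ∀ x, 1 ≤ x →
      g (x + 1) = g x + 1 - (x + 1 / 2) * (Real.log (x + 1) - Real.log x) := by
    intro x hx
    simp only [hg]
    rw [Real.Gamma_add_one (by linarith), Real.log_mul (by linarith)
      (Real.Gamma_pos_of_pos (by linarith)).ne']
    ring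
  -- The increment of g over a unit step lies between -(1/(4x) - 1/(4(x + 1))) and 0. So both -g and
  -- g - 1/(4x) are nondecreasing under unit steps, and their minima on [1, 2] bound g from above
  -- and below.
  obtain ⟨x₁, -, h₁⟩ := exists_forall_le_of_le_add_one (f := fun x => -g x) hcont.neg (by
    intro x hx
    rw [hstep x hx]
    linarith [Real.one_le_add_half_mul_log (x := x) (by linarith)])
  obtain ⟨x₂, -, h₂⟩ := exists_forall_le_of_le_add_one (f := fun x => g x - 1 / (4 * x))
    (hcont.sub (continuousOn_const.div (continuousOn_const.mul continuousOn_id) fun x hx => by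
      have := hx.1; change 4 * x ≠ 0; linarith)) (by
    intro x hx
    rw [hstep x hx]
    linarith [Real.add_half_mul_log_le (x := x) (by linarith)])
  refine ⟨max (g x₁) (-(g x₂ - 1 / (4 * x₂))), fun x hx => ?_⟩
  change |g x| ≤ _
  rw [abs_le]
  have h3 := h₁ x hx
  have h4 := h₂ x hx
  have h5 : 0 ≤ 1 / (4 * x) := by positivity
  refine ⟨?_, le_max_of_le_left (by linarith)⟩
  have := le_max_right (g x₁) (-(g x₂ - 1 / (4 * x₂)))
  linarith

/-- Stirling's formula for `Γ (A t + α)` as `t → ∞`. -/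
theorem Real.log_Gamma_linear_isBigO {A : ℝ} (hA : 0 < A) (α : ℝ) :
    (fun t : ℝ => Real.log (Real.Gamma (A * t + α)) -
      ((A * t + α - 1 / 2) * Real.log t + (A * Real.log A - A) * t)) =O[atTop]
        (fun _ => (1 : ℝ)) := by
  obtain ⟨K, hK⟩ := Real.exists_abs_log_Gamma_sub_le
  have hlim : Tendsto (fun t : ℝ => A * t + α) atTop atTop :=
    tendsto_atTop_add_const_right _ _ (tendsto_id.const_mul_atTop hA)
  have h1 : (fun t : ℝ => Real.log (Real.Gamma (A * t + α)) -
      ((A * t + α - 1 / 2) * Real.log (A * t + α) - (A * t + α))) =O[atTop] (fun _ => (1 : ℝ)) := by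
    refine IsBigO.of_bound K ?_
    filter_upwards [hlim.eventually_ge_atTop 1] with t ht
    simpa using hK _ ht
  have hlog : Tendsto (fun t : ℝ => t * Real.log (1 + (α / A) / t)) atTop (𝓝 (α / A)) :=
    Real.tendsto_mul_log_one_add_div_atTop _
  have hlog0 : Tendsto (fun t : ℝ => Real.log (1 + (α / A) / t)) atTop (𝓝 0) := by
    have h := hlog.mul tendsto_inv_atTop_zero
    rw [mul_zero] at h
    refine h.congr' ?_
    filter_upwards [eventually_gt_atTop 0] with t ht
    field_simp
  have h2 : (fun t : ℝ => A * (t * Real.log (1 + (α / A) / t)) +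
      (α - 1 / 2) * Real.log (1 + (α / A) / t) + ((α - 1 / 2) * Real.log A - α))
        =O[atTop] (fun _ => (1 : ℝ)) :=
    (((hlog.const_mul A).add (hlog0.const_mul (α - 1 / 2))).add_const _).isBigO_one ℝ
  refine (h1.add h2).congr' ?_ EventuallyEq.rfl
  filter_upwards [eventually_gt_atTop 0, hlim.eventually_gt_atTop 0] with t ht ht'
  have e : Real.log (A * t + α) = Real.log A + Real.log t + Real.log (1 + (α / A) / t) := by
    have h0 : 1 + (α / A) / t = (A * t + α) / (A * t) := by field_simp
    rw [h0, Real.log_div ht'.ne' (by positivity), Real.log_mul hA.ne' ht.ne']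
    ring
  rw [e]
  ring

theorem Complex.norm_Gamma_le_Gamma_re {s : ℂ} (hs : 0 < s.re) :
    ‖Complex.Gamma s‖ ≤ Real.Gamma s.re := by
  rw [Complex.Gamma_eq_integral hs, Real.Gamma_eq_integral hs, Complex.GammaIntegral]
  refine (norm_integral_le_integral_norm _).trans (le_of_eq ?_)
  refine setIntegral_congr_fun measurableSet_Ioi fun x hx => ?_
  simp only [norm_mul]
  rw [Complex.norm_cpow_eq_rpow_re_of_pos hx]
  simp [Complex.norm_exp]

/-- On a horizontal line, `‖Γ s‖` is bounded below by a multiple of `Γ (re s)`. -/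
theorem Complex.exists_mul_Gamma_re_le (y : ℝ) : ∃ c > 0, ∀ x : ℝ, 1 ≤ x →
    c * Real.Gamma x ≤ ‖Complex.Gamma ((x : ℂ) + (y : ℂ) * Complex.I)‖ := by
  set F : ℝ → ℝ := fun x => ‖Complex.Gamma ((x : ℂ) + (y : ℂ) * Complex.I)‖ / Real.Gamma x with hF
  have hne : ∀ x : ℝ, 1 ≤ x → ∀ m : ℕ, (x : ℂ) + (y : ℂ) * Complex.I ≠ -m := by
    intro x hx m h
    have := congrArg Complex.re h
    simp at this
    have := m.cast_nonneg (α := ℝ)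
    linarith
  have hcont : ContinuousOn F (Icc 1 2) := by
    refine ContinuousOn.div (ContinuousOn.norm fun x hx => ?_) Real.continuousOn_Gamma_Icc
      fun x hx => (Real.Gamma_pos_of_pos (by linarith [hx.1])).ne'
    have hin : ContinuousAt (fun x : ℝ => (x : ℂ) + (y : ℂ) * Complex.I) x := by fun_prop
    exact (ContinuousAt.comp (f := fun x : ℝ => (x : ℂ) + (y : ℂ) * Complex.I)
      (Complex.differentiableAt_Gamma _ (hne x hx.1)).continuousAt hin).continuousWithinAt
  -- By the functional equation a unit step multiplies the ratio by |x + iy|/x ≥ 1.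
  obtain ⟨x₀, hx₀, hmin⟩ := exists_forall_le_of_le_add_one hcont (by
    intro x hx
    have hx0 : 0 < x := by linarith
    have hz : (x : ℂ) + (y : ℂ) * Complex.I ≠ 0 := by simpa using hne x hx 0
    simp only [hF]
    push_cast
    rw [show (x : ℂ) + 1 + (y : ℂ) * Complex.I = (x + y * Complex.I) + 1 by ring,
      Complex.Gamma_add_one _ hz, Real.Gamma_add_one hx0.ne', norm_mul]
    have hG := Real.Gamma_pos_of_pos hx0
    rw [div_le_div_iff₀ hG (by positivity)]
    have hxn : x ≤ ‖(x : ℂ) + y * Complex.I‖ := by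
      have := Complex.abs_re_le_norm ((x : ℂ) + y * Complex.I)
      simp at this
      exact (le_abs_self x).trans this
    calc _ = ‖Complex.Gamma ((x : ℂ) + (y : ℂ) * Complex.I)‖ * Real.Gamma x * x := by ring
      _ ≤ ‖Complex.Gamma ((x : ℂ) + (y : ℂ) * Complex.I)‖ * Real.Gamma x *
          ‖(x : ℂ) + y * Complex.I‖ := by gcongr
      _ = _ := by ring)
  refine ⟨F x₀, ?_, fun x hx => ?_⟩
  · exact div_pos (norm_pos_iff.2 (Complex.Gamma_ne_zero (hne x₀ hx₀.1)))
      (Real.Gamma_pos_of_pos (by linarith [hx₀.1]))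
  · have := hmin x hx
    rwa [le_div_iff₀ (Real.Gamma_pos_of_pos (by linarith))] at this

/-! ### Γ and 1/Γ far to the left, by the reflection formula -/

theorem Complex.norm_sin_le_cosh (z : ℂ) : ‖Complex.sin z‖ ≤ Real.cosh z.im := by
  rw [Complex.sin, Real.cosh_eq, norm_div, norm_mul, Complex.norm_I, mul_one]
  have h := norm_sub_le (Complex.exp (-z * Complex.I)) (Complex.exp (z * Complex.I))
  rw [Complex.norm_exp, Complex.norm_exp] at h
  simp at h ⊢
  linarith

/-- In the reflection formula this keeps Γ away from its poles: on a horizontal line off the real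
axis the lower bound is a positive constant. -/
theorem Complex.sinh_abs_im_le_norm_sin (z : ℂ) : Real.sinh |z.im| ≤ ‖Complex.sin z‖ := by
  rw [← Real.abs_sinh, Complex.sin, Real.sinh_eq, norm_div, norm_mul, Complex.norm_I, mul_one,
    abs_div]
  have h := abs_norm_sub_norm_le (Complex.exp (-z * Complex.I)) (Complex.exp (z * Complex.I))
  rw [Complex.norm_exp, Complex.norm_exp] at h
  simp at h ⊢
  linarith

theorem Real.Gamma_linear_isBigO {A : ℝ} (hA : 0 < A) (α : ℝ) :
    (fun t : ℝ => Real.Gamma (A * t + α)) =O[atTop]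
      (fun t : ℝ => Real.exp ((A * t + α - 1 / 2) * Real.log t + (A * Real.log A - A) * t)) := by
  obtain ⟨K, hK⟩ := (Real.log_Gamma_linear_isBigO hA α).bound
  refine IsBigO.of_bound (Real.exp K) ?_
  have hlim : Tendsto (fun t : ℝ => A * t + α) atTop atTop :=
    tendsto_atTop_add_const_right _ _ (tendsto_id.const_mul_atTop hA)
  filter_upwards [hK, hlim.eventually_gt_atTop 0] with t ht h0
  have hG := Real.Gamma_pos_of_pos h0
  rw [Real.norm_of_nonneg hG.le, Real.norm_of_nonneg (Real.exp_pos _).le, ← Real.exp_add,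
    ← Real.log_le_iff_le_exp hG]
  simp only [Real.norm_eq_abs, abs_one, mul_one] at ht
  linarith [(abs_le.1 ht).2]

theorem Real.inv_Gamma_linear_isBigO {A : ℝ} (hA : 0 < A) (α : ℝ) :
    (fun t : ℝ => (Real.Gamma (A * t + α))⁻¹) =O[atTop]
      (fun t : ℝ => Real.exp (-((A * t + α - 1 / 2) * Real.log t + (A * Real.log A - A) * t))) := by
  obtain ⟨K, hK⟩ := (Real.log_Gamma_linear_isBigO hA α).bound
  refine IsBigO.of_bound (Real.exp K) ?_
  have hlim : Tendsto (fun t : ℝ => A * t + α) atTop atTop :=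
    tendsto_atTop_add_const_right _ _ (tendsto_id.const_mul_atTop hA)
  filter_upwards [hK, hlim.eventually_gt_atTop 0] with t ht h0
  have hG := Real.Gamma_pos_of_pos h0
  rw [Real.norm_of_nonneg (inv_nonneg.2 hG.le), Real.norm_of_nonneg (Real.exp_pos _).le,
    ← Real.exp_add, ← Real.log_le_iff_le_exp (inv_pos.2 hG), Real.log_inv]
  simp only [Real.norm_eq_abs, abs_one, mul_one] at ht
  linarith [(abs_le.1 ht).1]

/-- Decay of `Γ` to the left, on a horizontal line that avoids the poles. -/
theorem Complex.Gamma_left_isBigO {B φ : ℝ} (hB : 0 < B) (hφ : φ ≠ 0) (b : ℝ) :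
    (fun t : ℝ => Complex.Gamma ((B : ℂ) * ((-t : ℝ) + (φ : ℂ) * Complex.I) + (b : ℂ))) =O[atTop]
      (fun t : ℝ => Real.exp
        (-((B * t + (1 - b) - 1 / 2) * Real.log t + (B * Real.log B - B) * t))) := by
  refine IsBigO.trans ?_ (Real.inv_Gamma_linear_isBigO hB (1 - b))
  obtain ⟨c, hc, hcG⟩ := Complex.exists_mul_Gamma_re_le (-(B * φ))
  obtain ⟨S, hS⟩ : ∃ S, S = Real.sinh |Real.pi * (B * φ)| := ⟨_, rfl⟩
  have hs : 0 < S := hS ▸ Real.sinh_pos_iff.2 (by positivity)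
  refine IsBigO.of_bound (Real.pi / (S * c)) ?_
  have hlim : Tendsto (fun t : ℝ => B * t + (1 - b)) atTop atTop :=
    tendsto_atTop_add_const_right _ _ (tendsto_id.const_mul_atTop hB)
  filter_upwards [hlim.eventually_ge_atTop 1] with t ht
  have hG := Real.Gamma_pos_of_pos (show 0 < B * t + (1 - b) by linarith)
  set w : ℂ := (B : ℂ) * ((-t : ℝ) + (φ : ℂ) * Complex.I) + (b : ℂ) with hw
  have h1w : 1 - w = ((B * t + (1 - b) : ℝ) : ℂ) + ((-(B * φ) : ℝ) : ℂ) * Complex.I := by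
    rw [hw]; push_cast; ring
  have hG1 : c * Real.Gamma (B * t + (1 - b)) ≤ ‖Complex.Gamma (1 - w)‖ := by
    rw [h1w]; exact hcG _ ht
  have hsin : S ≤ ‖Complex.sin (Real.pi * w)‖ := by
    refine le_trans (le_of_eq ?_) (Complex.sinh_abs_im_le_norm_sin _)
    simp [hw, hS]
  have hrefl := congrArg norm (Complex.Gamma_mul_Gamma_one_sub w)
  rw [norm_mul, norm_div, Complex.norm_real, Real.norm_of_nonneg Real.pi_pos.le,
    eq_div_iff (by linarith)] at hrefl
  rw [Real.norm_of_nonneg (inv_nonneg.2 hG.le), ← div_eq_mul_inv, div_div, le_div_iff₀ (by positivity),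
    ← hrefl]
  calc _ = ‖Complex.Gamma w‖ * (c * Real.Gamma (B * t + (1 - b))) *
        S := by ring
    _ ≤ _ := by gcongr

/-- Growth of `1 / Γ` to the left, on a horizontal line. -/
theorem Complex.inv_Gamma_left_isBigO {A : ℝ} (hA : 0 < A) (φ a : ℝ) :
    (fun t : ℝ => (Complex.Gamma ((A : ℂ) * ((-t : ℝ) + (φ : ℂ) * Complex.I) + (a : ℂ)))⁻¹)
      =O[atTop] (fun t : ℝ => Real.exp
        ((A * t + (1 - a) - 1 / 2) * Real.log t + (A * Real.log A - A) * t)) := by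
  refine IsBigO.trans ?_ (Real.Gamma_linear_isBigO hA (1 - a))
  refine IsBigO.of_bound (Real.cosh (Real.pi * (A * φ)) / Real.pi) ?_
  have hlim : Tendsto (fun t : ℝ => A * t + (1 - a)) atTop atTop :=
    tendsto_atTop_add_const_right _ _ (tendsto_id.const_mul_atTop hA)
  filter_upwards [hlim.eventually_ge_atTop 1] with t ht
  have hG := Real.Gamma_pos_of_pos (show 0 < A * t + (1 - a) by linarith)
  set w : ℂ := (A : ℂ) * ((-t : ℝ) + (φ : ℂ) * Complex.I) + (a : ℂ) with hw
  have h1w : (1 - w).re = A * t + (1 - a) := by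
    simp [hw]; ring
  have hG1 : ‖Complex.Gamma (1 - w)‖ ≤ Real.Gamma (A * t + (1 - a)) := by
    rw [← h1w]; exact Complex.norm_Gamma_le_Gamma_re (by rw [h1w]; linarith)
  have hsin : ‖Complex.sin (Real.pi * w)‖ ≤ Real.cosh (Real.pi * (A * φ)) := by
    refine (Complex.norm_sin_le_cosh _).trans (le_of_eq ?_)
    simp [hw]
  have hrefl := congrArg norm (Complex.Gamma_mul_Gamma_one_sub w)
  rw [norm_mul, norm_div, Complex.norm_real, Real.norm_of_nonneg Real.pi_pos.le] at hrefl
  rw [Real.norm_of_nonneg hG.le, norm_inv]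
  -- Here φ = 0 is allowed, so w may be a pole. There `Complex.Gamma` has the default value 0, and
  -- its inverse 0 is the true value of the entire function 1/Γ.
  by_cases h0 : ‖Complex.Gamma w‖ = 0
  · rw [h0, inv_zero]; positivity
  by_cases h1 : ‖Complex.sin (Real.pi * w)‖ = 0
  · rw [h1, div_zero] at hrefl
    have h2 : ‖Complex.Gamma (1 - w)‖ = 0 := (mul_eq_zero.1 hrefl).resolve_left h0
    refine absurd (norm_eq_zero.1 h2) (Complex.Gamma_ne_zero_of_re_pos ?_)
    rw [h1w]; linarith
  have h3 : ‖Complex.Gamma w‖⁻¹ =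
      ‖Complex.sin (Real.pi * w)‖ / Real.pi * ‖Complex.Gamma (1 - w)‖ := by
    have := Real.pi_pos
    field_simp
    rw [eq_div_iff h1] at hrefl
    linarith
  rw [h3]
  gcongr

/-! ### The Mellin-Barnes integrand -/

/-- The quotient `∏ₖ Γ(Bₖ s + bₖ) / ∏ₖ Γ(Aₖ s + aₖ)`. -/
noncomputable def gammaQuotient {m : ℕ} (a A b B : Fin m → ℝ) (s : ℂ) : ℂ :=
  (∏ k, Complex.Gamma ((B k : ℂ) * s + (b k : ℂ))) /
    ∏ k, Complex.Gamma ((A k : ℂ) * s + (a k : ℂ))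

theorem foxRadius_pos {m : ℕ} {A B : Fin m → ℝ} (hA : ∀ k, 0 < A k) (hB : ∀ k, 0 < B k) :
    0 < foxRadius A B :=
  mul_pos (Finset.prod_pos fun k _ => Real.rpow_pos_of_pos (hA k) _)
    (Finset.prod_pos fun k _ => Real.rpow_pos_of_pos (hB k) _)

theorem log_foxRadius {m : ℕ} {A B : Fin m → ℝ} (hA : ∀ k, 0 < A k) (hB : ∀ k, 0 < B k) :
    Real.log (foxRadius A B) = ∑ k, B k * Real.log (B k) - ∑ k, A k * Real.log (A k) := by
  rw [foxRadius, Real.log_mul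
    (Finset.prod_pos fun k _ => Real.rpow_pos_of_pos (hA k) _).ne'
    (Finset.prod_pos fun k _ => Real.rpow_pos_of_pos (hB k) _).ne',
    Real.log_prod fun k _ => (Real.rpow_pos_of_pos (hA k) _).ne',
    Real.log_prod fun k _ => (Real.rpow_pos_of_pos (hB k) _).ne',
    Finset.sum_congr rfl fun k _ => Real.log_rpow (hA k) _,
    Finset.sum_congr rfl fun k _ => Real.log_rpow (hB k) _]
  simp only [neg_mul, Finset.sum_neg_distrib]
  ring

/-- Asymptotic bound of the balanced Gamma quotient to the left, off the real axis. -/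
theorem gammaQuotient_isBigO {m : ℕ} {a A b B : Fin m → ℝ} (hA : ∀ k, 0 < A k)
    (hB : ∀ k, 0 < B k) (hAB : ∑ k, A k = ∑ k, B k) {φ : ℝ} (hφ : φ ≠ 0) :
    (fun t : ℝ => gammaQuotient a A b B ((-t : ℝ) + (φ : ℂ) * Complex.I)) =O[atTop]
      (fun t : ℝ => foxRadius A B ^ (-t) * t ^ (-(∑ k, a k - ∑ k, b k))) := by
  have h := (IsBigO.finsetProd (s := Finset.univ)
      fun k _ => Complex.Gamma_left_isBigO (hB k) hφ (b k)).mul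
    (IsBigO.finsetProd (s := Finset.univ) fun k _ => Complex.inv_Gamma_left_isBigO (hA k) φ (a k))
  refine h.congr' (Eventually.of_forall fun t => ?_) ?_
  · simp only [gammaQuotient, Finset.prod_inv_distrib, div_eq_mul_inv]
  · filter_upwards [eventually_gt_atTop 0] with t ht
    rw [← Real.exp_sum, ← Real.exp_sum, ← Real.exp_add, Real.rpow_def_of_pos (foxRadius_pos hA hB),
      Real.rpow_def_of_pos ht, ← Real.exp_add, log_foxRadius hA hB]
    congr 1
    -- After summation the terms in t log t and t cancel by ∑A = ∑B, and the halves cancel because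
    -- both products have m factors. What is left is -t log R and the power of t.
    have e1 : ∀ k, -((B k * t + (1 - b k) - 1 / 2) * Real.log t + (B k * Real.log (B k) - B k) * t)
        = B k * (t - t * Real.log t) + b k * Real.log t - (1 / 2) * Real.log t
          - B k * Real.log (B k) * t := fun k => by ring
    have e2 : ∀ k, (A k * t + (1 - a k) - 1 / 2) * Real.log t + (A k * Real.log (A k) - A k) * t
        = A k * (t * Real.log t - t) - a k * Real.log t + (1 / 2) * Real.log t
          + A k * Real.log (A k) * t := fun k => by ring
    simp only [e1, e2, Finset.sum_add_distrib, Finset.sum_sub_distrib, ← Finset.sum_mul, hAB]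
    ring

theorem Complex.continuous_Gamma_line {B φ : ℝ} (hB : 0 < B) (hφ : φ ≠ 0) (b : ℝ) :
    Continuous fun x : ℝ => Complex.Gamma ((B : ℂ) * (x + (φ : ℂ) * Complex.I) + (b : ℂ)) := by
  rw [continuous_iff_continuousAt]
  intro x
  refine ContinuousAt.comp (f := fun x : ℝ => (B : ℂ) * (x + (φ : ℂ) * Complex.I) + (b : ℂ))
    (Complex.differentiableAt_Gamma _ fun n h => ?_).continuousAt (by fun_prop)
  have := congrArg Complex.im h
  simp [hB.ne', hφ] at this

/-- Only the numerator can have poles, since 1/Γ is entire; hence no condition on a and A. -/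
theorem differentiableAt_gammaQuotient {m : ℕ} {a A b B : Fin m → ℝ} {s : ℂ}
    (hs : ∀ k, 0 < B k * s.re + b k) : DifferentiableAt ℂ (gammaQuotient a A b B) s := by
  have h : gammaQuotient a A b B = fun s => (∏ k, Complex.Gamma ((B k : ℂ) * s + (b k : ℂ))) *
      ∏ k, (fun w => (Complex.Gamma w)⁻¹) ((A k : ℂ) * s + (a k : ℂ)) := by
    funext s
    simp only [gammaQuotient, Finset.prod_inv_distrib, div_eq_mul_inv]
  rw [h]
  refine DifferentiableAt.mul (DifferentiableAt.fun_finsetProd fun k _ => ?_)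
    (DifferentiableAt.fun_finsetProd fun k _ => ?_)
  · refine DifferentiableAt.comp (f := fun s => (B k : ℂ) * s + (b k : ℂ)) s
      (Complex.differentiableAt_Gamma _ fun n h => ?_) (by fun_prop)
    have := congrArg Complex.re h
    simp at this
    have := hs k
    have := n.cast_nonneg (α := ℝ)
    linarith
  · exact DifferentiableAt.comp (f := fun s => (A k : ℂ) * s + (a k : ℂ)) s
      (Complex.differentiable_one_div_Gamma _) (by fun_prop)

theorem continuous_gammaQuotient_line {m : ℕ} {a A b B : Fin m → ℝ} (hA : ∀ k, 0 < A k)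
    (hB : ∀ k, 0 < B k) {φ : ℝ} (hφ : φ ≠ 0) :
    Continuous fun x : ℝ => gammaQuotient a A b B (x + (φ : ℂ) * Complex.I) := by
  have hne : ∀ (k : Fin m) (x : ℝ),
      Complex.Gamma ((A k : ℂ) * (x + (φ : ℂ) * Complex.I) + (a k : ℂ)) ≠ 0 := by
    intro k x
    refine Complex.Gamma_ne_zero fun n h => ?_
    have := congrArg Complex.im h
    simp [(hA k).ne', hφ] at this
  refine Continuous.div (continuous_finsetProd _ fun k _ => Complex.continuous_Gamma_line (hB k) hφ _)
    (continuous_finsetProd _ fun k _ => Complex.continuous_Gamma_line (hA k) hφ _) fun x => ?_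
  exact Finset.prod_ne_zero_iff.2 fun k _ => hne k x

/-- The Gamma quotient on a horizontal ray, up to a point left of the imaginary axis. -/
theorem exists_norm_gammaQuotient_le {m : ℕ} {a A b B : Fin m → ℝ} (hA : ∀ k, 0 < A k)
    (hB : ∀ k, 0 < B k) (hAB : ∑ k, A k = ∑ k, B k) {φ c : ℝ} (hφ : φ ≠ 0) (hc : c < 0) :
    ∃ C, ∀ x ≤ c, ‖gammaQuotient a A b B (x + (φ : ℂ) * Complex.I)‖ ≤
      C * (foxRadius A B ^ x * (-x) ^ (-(∑ k, a k - ∑ k, b k))) := by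
  obtain ⟨C, hC⟩ := (gammaQuotient_isBigO (a := a) (b := b) hA hB hAB hφ).bound
  obtain ⟨T, hT⟩ := eventually_atTop.1 hC
  have hR := foxRadius_pos hA hB
  set g : ℝ → ℝ := fun x => foxRadius A B ^ x * (-x) ^ (-(∑ k, a k - ∑ k, b k)) with hg
  have hgpos : ∀ x ≤ c, 0 < g x := fun x hx =>
    mul_pos (Real.rpow_pos_of_pos hR _) (Real.rpow_pos_of_pos (by linarith) _)
  have hcont : ContinuousOn
      (fun x : ℝ => ‖gammaQuotient a A b B (x + (φ : ℂ) * Complex.I)‖ / g x) (Icc (-T) c) := by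
    refine (continuous_gammaQuotient_line hA hB hφ).norm.continuousOn.div ?_
      fun x hx => (hgpos x hx.2).ne'
    refine ContinuousOn.mul (fun x _ => (Real.continuousAt_const_rpow hR.ne').continuousWithinAt)
      (ContinuousOn.rpow_const continuousOn_neg fun x hx => Or.inl ?_)
    have := hx.2
    linarith
  obtain ⟨K, hK⟩ := isCompact_Icc.bddAbove_image hcont
  refine ⟨max C K, fun x hx => ?_⟩
  by_cases hxT : x ≤ -T
  · have h1 := hT (-x) (by linarith)
    rw [neg_neg] at h1
    rw [Real.norm_of_nonneg (hgpos x hx).le] at h1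
    exact h1.trans (mul_le_mul_of_nonneg_right (le_max_left _ _) (hgpos x hx).le)
  · have h1 := hK ⟨x, ⟨by linarith, hx⟩, rfl⟩
    rw [div_le_iff₀ (hgpos x hx)] at h1
    exact h1.trans (mul_le_mul_of_nonneg_right (le_max_right _ _) (hgpos x hx).le)

/-! ### Integrability of the Fox function -/

/-- Tonelli with the z-integral taken first: it converges at 0 exactly when Re s < 0 and equals
R^(-Re s)/(-Re s). The measure ν parametrizes one side of the contour s. -/
theorem integrable_mellinBarnes {ν : Measure ℝ} [SFinite ν] {R : ℝ} (hR : 0 < R) {g : ℝ → ℂ}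
    {s : ℝ → ℂ} (hg : AEStronglyMeasurable g ν) (hs : Measurable s) (hneg : ∀ᵐ x ∂ν, (s x).re < 0)
    (hint : Integrable (fun x => ‖g x‖ * (R ^ (-(s x).re) / (-(s x).re))) ν) :
    Integrable (fun p : ℝ × ℝ => g p.2 * (p.1 : ℂ) ^ (-(s p.2)) / (p.1 : ℂ))
      ((volume.restrict (Ioo 0 R)).prod ν) := by
  have hmeas : AEStronglyMeasurable
      (fun p : ℝ × ℝ => g p.2 * (p.1 : ℂ) ^ (-(s p.2)) / (p.1 : ℂ))
      ((volume.restrict (Ioo 0 R)).prod ν) := by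
    simp only [div_eq_mul_inv]
    refine (hg.comp_snd.mul ?_).mul ?_
    · exact ((Complex.measurable_ofReal.comp measurable_fst).pow
        (hs.comp measurable_snd).neg).aestronglyMeasurable
    · exact (Complex.measurable_ofReal.comp measurable_fst).inv.aestronglyMeasurable
  have hnorm : ∀ x : ℝ, ∀ z ∈ Ioo 0 R, ‖g x * (z : ℂ) ^ (-(s x)) / (z : ℂ)‖ =
      ‖g x‖ * z ^ (-(s x).re - 1) := by
    intro x z hz
    rw [norm_div, norm_mul, Complex.norm_cpow_eq_rpow_re_of_pos hz.1, Complex.norm_real,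
      Real.norm_of_nonneg hz.1.le, Real.rpow_sub_one hz.1.ne', Complex.neg_re, mul_div_assoc]
  have hpow : ∀ x : ℝ, (s x).re < 0 →
      IntegrableOn (fun z : ℝ => z ^ (-(s x).re - 1)) (Ioo 0 R) := by
    intro x hx
    have := (intervalIntegrable_iff_integrableOn_Ioo_of_le hR.le).1
      (intervalIntegral.intervalIntegrable_rpow' (a := 0) (b := R) (r := -(s x).re - 1)
        (by linarith))
    exact this
  rw [integrable_prod_iff' hmeas]
  refine ⟨?_, hint.congr ?_⟩
  · filter_upwards [hneg] with x hx
    have hm : AEStronglyMeasurable (fun z : ℝ => g x * (z : ℂ) ^ (-(s x)) / (z : ℂ))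
        (volume.restrict (Ioo 0 R)) :=
      ((((Complex.measurable_ofReal.pow_const _).const_mul _).div
        Complex.measurable_ofReal)).aestronglyMeasurable
    refine ((hpow x hx).const_mul ‖g x‖).mono' hm ?_
    refine (ae_restrict_iff' measurableSet_Ioo).2 (Eventually.of_forall fun z hz => ?_)
    exact (hnorm x z hz).le
  · filter_upwards [hneg] with x hx
    rw [setIntegral_congr_fun measurableSet_Ioo (hnorm x), integral_const_mul,
      ← integral_Ioc_eq_integral_Ioo, ← intervalIntegral.integral_of_le hR.le,
      integral_rpow (Or.inl (by linarith))]
    rw [sub_add_cancel, Real.zero_rpow (by linarith), sub_zero]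

/-- The vertical side of a left loop can be moved within the domain of holomorphy. -/
theorem LeftLoop.integral_eq_of_differentiableOn {m : ℕ} {b B : Fin m → ℝ} (L L' : LeftLoop b B)
    (h₁ : L'.φ₁ = L.φ₁) (h₂ : L'.φ₂ = L.φ₂) {F : ℂ → ℂ}
    (hi₁ : IntegrableOn (fun x : ℝ => F (x + (L.φ₁ : ℂ) * Complex.I)) (Iic L'.c))
    (hi₂ : IntegrableOn (fun x : ℝ => F (x + (L.φ₂ : ℂ) * Complex.I)) (Iic L'.c))
    (hF : DifferentiableOn ℂ F (uIcc L'.c L.c ×ℂ uIcc L.φ₁ L.φ₂)) :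
    L.integral F = L'.integral F := by
  have hcauchy := Complex.integral_boundary_rect_eq_zero_of_differentiableOn F
    ⟨L'.c, L.φ₁⟩ ⟨L.c, L.φ₂⟩ hF
  simp only [smul_eq_mul] at hcauchy
  -- The segment between the two abscissae enters as an oriented integral, so their order does not
  -- matter.
  have hray : ∀ φ : ℝ, φ ∈ uIcc L.φ₁ L.φ₂ →
      IntegrableOn (fun x : ℝ => F (x + (φ : ℂ) * Complex.I)) (Iic L'.c) →
      ∫ x in Iic L.c, F (x + (φ : ℂ) * Complex.I) = (∫ x in Iic L'.c, F (x + (φ : ℂ) * Complex.I))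
        + ∫ x in L'.c..L.c, F (x + (φ : ℂ) * Complex.I) := by
    intro φ hφ hi
    have hcont : ContinuousOn (fun x : ℝ => F (x + (φ : ℂ) * Complex.I)) (uIcc L'.c L.c) :=
      hF.continuousOn.comp (by fun_prop) fun x hx => by
        rw [Complex.mem_reProdIm]; simpa using ⟨hx, hφ⟩
    have hi' : IntegrableOn (fun x : ℝ => F (x + (φ : ℂ) * Complex.I)) (Iic L.c) := by
      refine (hi.union (hcont.integrableOn_uIcc)).mono_set fun x hx => ?_
      rcases le_total x L'.c with h | h
      · exact Or.inl h
      · exact Or.inr (mem_uIcc.2 (Or.inl ⟨h, hx⟩))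
    rw [← intervalIntegral.integral_Iic_sub_Iic hi hi']
    ring
  rw [LeftLoop.integral, LeftLoop.integral, h₁, h₂, hray _ left_mem_uIcc hi₁,
    hray _ right_mem_uIcc hi₂]
  linear_combination hcauchy

theorem foxIntegrand_eq {m : ℕ} (a A b B : Fin m → ℝ) (z : ℝ) (s : ℂ) :
    foxIntegrand a A b B z s = gammaQuotient a A b B s * (z : ℂ) ^ (-s) := rfl

/-- The factor R^x in the bound of the quotient cancels R^(-x), leaving (-x)^(-(∑a - ∑b) - 1). This
is where ∑b < ∑a is decisive. -/
theorem integrableOn_gammaQuotient_ray {m : ℕ} {a A b B : Fin m → ℝ} (hA : ∀ k, 0 < A k)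
    (hB : ∀ k, 0 < B k) (hAB : ∑ k, A k = ∑ k, B k) (hab : ∑ k, b k < ∑ k, a k)
    {φ c : ℝ} (hφ : φ ≠ 0) (hc : c < 0) :
    IntegrableOn (fun x : ℝ => ‖gammaQuotient a A b B (x + (φ : ℂ) * Complex.I)‖ *
      (foxRadius A B ^ (-x) / (-x))) (Iic c) := by
  obtain ⟨C, hC⟩ := exists_norm_gammaQuotient_le (a := a) (b := b) hA hB hAB hφ hc
  have hR := foxRadius_pos hA hB
  have hpow : IntegrableOn (fun x : ℝ => (-x) ^ (-(∑ k, a k - ∑ k, b k) - 1)) (Iic c) := by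
    have h := integrableOn_Ioi_rpow_of_lt (a := -(∑ k, a k - ∑ k, b k) - 1) (c := -c)
      (by linarith) (by linarith)
    rw [← integrableOn_Ici_iff_integrableOn_Ioi] at h
    have h2 := (Measure.measurePreserving_neg (volume : Measure ℝ)).integrableOn_comp_preimage
      (Homeomorph.neg ℝ).measurableEmbedding (f := fun x : ℝ => x ^ (-(∑ k, a k - ∑ k, b k) - 1))
      (s := Ici (-c))
    have h3 := h2.2 h
    simpa [Function.comp_def] using h3
  refine (hpow.const_mul C).mono' ?_ ?_
  · have h1 := (continuous_gammaQuotient_line (a := a) (b := b) hA hB hφ).norm.measurable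
    exact (h1.mul ((measurable_const.pow measurable_neg).div measurable_neg)).aestronglyMeasurable
  · refine (ae_restrict_iff' measurableSet_Iic).2 (Eventually.of_forall fun x hx => ?_)
    have hx0 : 0 < -x := by have : x ≤ c := hx; linarith
    have hRx := Real.rpow_pos_of_pos hR (-x)
    rw [Real.norm_of_nonneg (by positivity)]
    refine (mul_le_mul_of_nonneg_right (hC x hx) (by positivity)).trans (le_of_eq ?_)
    rw [Real.rpow_sub_one hx0.ne', Real.rpow_neg hR.le]
    have := (Real.rpow_pos_of_pos hR x).ne'
    field_simp

/-- `H^{m,0}_{m,m}[z] / z` is integrable on `(0, ∞)` if the poles of the integrand lie in the open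
left half plane and `∑ bₖ < ∑ aₖ`. -/
theorem integrableOn_foxH_div {m : ℕ} {a A b B : Fin m → ℝ} (hA : ∀ k, 0 < A k)
    (hB : ∀ k, 0 < B k) (hAB : ∑ k, A k = ∑ k, B k) (hab : ∑ k, b k < ∑ k, a k)
    (hb : ∀ k, 0 < b k) (L : LeftLoop b B) :
    IntegrableOn (fun z : ℝ => foxH a A b B L z / (z : ℂ)) (Ioi 0) := by
  have hR := foxRadius_pos hA hB
  set R := foxRadius A B with hRdef
  -- The given abscissa `L.c` may be nonnegative, where z^(-s)/z is not integrable at 0. Positivity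
  -- of the bₖ leaves room between the poles and 0.
  obtain ⟨c', hc'0, hc'⟩ : ∃ c' < 0, ∀ k, -(b k) / B k < c' := by
    have h : ∀ᶠ c' in 𝓝[<] (0 : ℝ), ∀ k, -(b k) / B k < c' :=
      eventually_all.2 fun k => mem_nhdsWithin_of_mem_nhds
        (Ioi_mem_nhds (div_neg_of_neg_of_pos (by linarith [hb k]) (hB k)))
    obtain ⟨c', h1, h2⟩ := (h.and self_mem_nhdsWithin).exists
    exact ⟨c', h2, h1⟩
  set L' : LeftLoop b B := { L with c := c', pole_lt := hc' } with hL'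
  have hre : ∀ (x : ℝ) (k : Fin m), min c' L.c ≤ x → 0 < B k * x + b k := by
    intro x k hx
    have h1 : -(b k) / B k < x := (lt_min (hc' k) (L.pole_lt k)).trans_le hx
    rw [div_lt_iff₀ (hB k)] at h1
    linarith
  have hray : ∀ φ : ℝ, φ ≠ 0 → Integrable (fun p : ℝ × ℝ =>
      gammaQuotient a A b B (p.2 + (φ : ℂ) * Complex.I) *
        (p.1 : ℂ) ^ (-((p.2 : ℂ) + (φ : ℂ) * Complex.I)) / (p.1 : ℂ))
      ((volume.restrict (Ioo 0 R)).prod (volume.restrict (Iic c'))) := by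
    intro φ hφ
    refine integrable_mellinBarnes (s := fun x : ℝ => (x : ℂ) + (φ : ℂ) * Complex.I)
      (g := fun x : ℝ => gammaQuotient a A b B (x + (φ : ℂ) * Complex.I)) hR
      (continuous_gammaQuotient_line hA hB hφ).aestronglyMeasurable (by fun_prop) ?_ ?_
    · refine (ae_restrict_iff' measurableSet_Iic).2 (Eventually.of_forall fun x hx => ?_)
      have : x ≤ c' := hx
      simp; linarith
    · simpa [IntegrableOn] using integrableOn_gammaQuotient_ray hA hB hAB hab hφ hc'0
  have hvert : Integrable (fun p : ℝ × ℝ =>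
      gammaQuotient a A b B (c' + (p.2 : ℂ) * Complex.I) *
        (p.1 : ℂ) ^ (-((c' : ℂ) + (p.2 : ℂ) * Complex.I)) / (p.1 : ℂ))
      ((volume.restrict (Ioo 0 R)).prod (volume.restrict (Ioc L.φ₁ L.φ₂))) := by
    have hcont : Continuous fun y : ℝ => gammaQuotient a A b B (c' + (y : ℂ) * Complex.I) := by
      rw [continuous_iff_continuousAt]
      intro y
      refine ContinuousAt.comp (f := fun y : ℝ => (c' : ℂ) + (y : ℂ) * Complex.I)
        (differentiableAt_gammaQuotient fun k => ?_).continuousAt (by fun_prop)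
      simpa using hre c' k (min_le_left _ _)
    refine integrable_mellinBarnes (s := fun y : ℝ => (c' : ℂ) + (y : ℂ) * Complex.I)
      (g := fun y : ℝ => gammaQuotient a A b B (c' + (y : ℂ) * Complex.I)) hR
      hcont.aestronglyMeasurable (by fun_prop) (Eventually.of_forall fun y => by simpa using hc'0) ?_
    simpa using ((hcont.norm.integrableOn_Icc (a := L.φ₁) (b := L.φ₂)).mono_set
      Ioc_subset_Icc_self).mul_const _
  have hφ₁ := L.φ₁_neg.ne
  have hφ₂ := L.φ₂_pos.ne'
  have hmain : IntegrableOn (fun z : ℝ => foxH a A b B L z / (z : ℂ)) (Ioo 0 R) := by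
    have hint := (((hray _ hφ₁).integral_prod_left.add
      (hvert.integral_prod_left.const_mul Complex.I)).sub
        (hray _ hφ₂).integral_prod_left).const_mul (1 / (2 * (Real.pi : ℂ) * Complex.I))
    refine hint.congr ?_
    -- Fubini makes both ray integrals converge absolutely for almost every z, as the change of
    -- contour requires.
    filter_upwards [(hray _ hφ₁).prod_right_ae, (hray _ hφ₂).prod_right_ae,
      ae_restrict_mem measurableSet_Ioo] with z h1 h2 hz
    have hz0 : (z : ℂ) ≠ 0 := by exact_mod_cast hz.1.ne'
    have hcancel : ∀ φ : ℝ, Integrable (fun x : ℝ =>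
        gammaQuotient a A b B (x + (φ : ℂ) * Complex.I) *
        (z : ℂ) ^ (-((x : ℂ) + (φ : ℂ) * Complex.I)) / (z : ℂ)) (volume.restrict (Iic c')) →
        IntegrableOn (fun x : ℝ => foxIntegrand a A b B z (x + (φ : ℂ) * Complex.I)) (Iic c') := by
      intro φ h
      refine (h.mul_const (z : ℂ)).congr (Eventually.of_forall fun x => ?_)
      simp only [foxIntegrand_eq, div_mul_cancel₀ _ hz0]
    have hdef : L.integral (foxIntegrand a A b B z) = L'.integral (foxIntegrand a A b B z) := by
      refine L.integral_eq_of_differentiableOn L' rfl rfl (hcancel _ h1) (hcancel _ h2) ?_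
      intro s hs
      rw [Complex.mem_reProdIm] at hs
      refine DifferentiableAt.differentiableWithinAt (DifferentiableAt.mul
        (differentiableAt_gammaQuotient fun k => hre _ k hs.1.1) ?_)
      exact (differentiableAt_id.neg).const_cpow (Or.inl hz0)
    simp only [foxH, if_pos (show 0 < z ∧ z < foxRadius A B from hz), hdef]
    simp only [LeftLoop.integral, hL', foxIntegrand_eq, integral_div, Pi.add_apply, Pi.sub_apply,
      intervalIntegral.integral_of_le (L.φ₁_neg.trans L.φ₂_pos).le]
    ring
  have hzero : IntegrableOn (fun z : ℝ => foxH a A b B L z / (z : ℂ)) (Ici R) := by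
    refine integrableOn_zero.congr_fun (fun z hz => ?_) measurableSet_Ici
    rw [foxH, if_neg fun h => absurd h.2 (not_lt.2 hz), zero_div]
  refine (hmain.union hzero).mono_set fun z hz => ?_
  rcases lt_or_ge z R with h | h
  · exact Or.inl ⟨hz, h⟩
  · exact Or.inr h

/-! ### Translations of Schwartz functions -/

/-- Mean value inequality on the ball of radius |x| ≤ 1 about y, where the weights 1 + |y| and 1 +
|w| differ by a factor of at most 2. -/
theorem SchwartzMap.exists_seminorm_compSubConst_sub_le (φ : 𝓢(ℝ, ℂ)) (k n : ℕ) :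
    ∃ C : ℝ, ∀ x : ℝ, |x| ≤ 1 →
      SchwartzMap.seminorm ℂ k n (φ.compSubConstCLM ℂ x - φ) ≤ C * |x| := by
  set D : ℝ := 2 ^ k * ((Finset.Iic (k, n + 1)).sup fun m => SchwartzMap.seminorm ℂ m.1 m.2) φ
    with hD
  have hDw : ∀ w : ℝ, (1 + |w|) ^ k * ‖iteratedDeriv (n + 1) φ w‖ ≤ D := fun w => by
    have := SchwartzMap.one_add_le_sup_seminorm_apply (𝕜 := ℂ) (m := (k, n + 1)) le_rfl le_rfl φ w
    rwa [norm_iteratedFDeriv_eq_norm_iteratedDeriv] at this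
  have hD0 : 0 ≤ D := le_trans (by positivity) (hDw 0)
  refine ⟨2 ^ k * D, fun x hx => SchwartzMap.seminorm_le_bound' ℂ k n _ (by positivity) fun y => ?_⟩
  have hsm : ∀ n : ℕ, ContDiff ℝ n φ := fun n => φ.smooth n
  have e1 : iteratedDeriv n (φ.compSubConstCLM ℂ x - φ) y =
      iteratedDeriv n φ (y - x) - iteratedDeriv n φ y := by
    have h1 : ((φ.compSubConstCLM ℂ x - φ : 𝓢(ℝ, ℂ)) : ℝ → ℂ) = (fun z => φ (z - x)) - φ := rfl
    rw [h1, iteratedDeriv_sub, iteratedDeriv_comp_sub_const]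
    · exact ((hsm n).comp (contDiff_id.sub contDiff_const)).contDiffAt
    · exact (hsm n).contDiffAt
  rw [e1]
  have hd : Differentiable ℝ (iteratedDeriv n φ) :=
    (hsm (n + 1)).differentiable_iteratedDeriv n (by exact_mod_cast n.lt_succ_self)
  have hmvt := Convex.norm_image_sub_le_of_norm_deriv_le (f := iteratedDeriv n φ)
    (s := Metric.closedBall y |x|) (x := y) (y := y - x) (C := 2 ^ k * D / (1 + |y|) ^ k)
    (fun w _ => hd w) (fun w hw => by
      rw [← iteratedDeriv_succ, le_div_iff₀ (by positivity)]
      rw [Metric.mem_closedBall, Real.dist_eq] at hw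
      have h2 : 1 + |y| ≤ 2 * (1 + |w|) := by
        have := abs_sub_abs_le_abs_sub y w
        rw [abs_sub_comm] at hw
        have := abs_nonneg w
        linarith
      calc ‖iteratedDeriv (n + 1) φ w‖ * (1 + |y|) ^ k
          ≤ ‖iteratedDeriv (n + 1) φ w‖ * (2 * (1 + |w|)) ^ k := by gcongr
        _ = 2 ^ k * ((1 + |w|) ^ k * ‖iteratedDeriv (n + 1) φ w‖) := by rw [mul_pow]; ring
        _ ≤ 2 ^ k * D := by gcongr; exact hDw w)
    (convex_closedBall _ _) (Metric.mem_closedBall_self (abs_nonneg x)) (by simp)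
  have e2 : ‖y - x - y‖ = |x| := by simp
  rw [e2] at hmvt
  calc |y| ^ k * ‖iteratedDeriv n φ (y - x) - iteratedDeriv n φ y‖
      ≤ (1 + |y|) ^ k * (2 ^ k * D / (1 + |y|) ^ k * |x|) := by
        gcongr
        linarith
    _ = 2 ^ k * D * |x| := by field_simp

theorem SchwartzMap.tendsto_compSubConstCLM_zero (φ : 𝓢(ℝ, ℂ)) :
    Tendsto (fun x : ℝ => φ.compSubConstCLM ℂ x) (𝓝 0) (𝓝 φ) := by
  rw [(schwartz_withSeminorms ℂ ℝ ℂ).tendsto_nhds]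
  rintro ⟨k, n⟩ ε hε
  obtain ⟨C, hC⟩ := SchwartzMap.exists_seminorm_compSubConst_sub_le φ k n
  have hlim : Tendsto (fun x : ℝ => C * |x|) (𝓝 0) (𝓝 0) := by
    have : Continuous fun x : ℝ => C * |x| := by fun_prop
    simpa using this.tendsto 0
  filter_upwards [hlim.eventually_lt_const hε, Metric.closedBall_mem_nhds (0 : ℝ) one_pos]
    with x hx hx1
  exact (hC x (by simpa using hx1)).trans_lt hx

theorem SchwartzMap.continuous_compSubConstCLM (φ : 𝓢(ℝ, ℂ)) :
    Continuous (fun x : ℝ => φ.compSubConstCLM ℂ x) := by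
  rw [continuous_iff_continuousAt]
  intro x₀
  have h := (SchwartzMap.tendsto_compSubConstCLM_zero (φ.compSubConstCLM ℂ x₀)).comp
    (show Tendsto (fun x : ℝ => x - x₀) (𝓝 x₀) (𝓝 0) by
      have hc : Continuous fun x : ℝ => x - x₀ := by fun_prop
      simpa using hc.tendsto x₀)
  refine h.congr fun x => ?_
  simp [SchwartzMap.compSubConstCLM_comp]

/-! ### The Poisson kernel -/

theorem continuous_poissonKernelLine (t : ℝ) : Continuous (poissonKernelLine t) := by
  unfold poissonKernelLine
  refine continuous_const.mul (continuous_const.mul (continuous_const.div (by fun_prop) fun x => ?_))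
  positivity

theorem poissonKernelLine_nonneg {t : ℝ} (ht : 0 < t) (x : ℝ) : 0 ≤ poissonKernelLine t x := by
  unfold poissonKernelLine
  positivity

theorem poissonKernelLine_le {t : ℝ} (ht : 0 < t) (x : ℝ) :
    poissonKernelLine t x ≤ t⁻¹ * (1 / Real.pi) := by
  unfold poissonKernelLine
  gcongr
  refine mul_le_of_le_one_right (by positivity) ?_
  rw [div_le_one (by positivity)]
  nlinarith [sq_nonneg (x / t)]

theorem norm_poissonKernelLine_le {t : ℝ} (ht : 0 < t) (x : ℝ) :
    ‖(poissonKernelLine t x : ℂ)‖ ≤ t⁻¹ * (1 / Real.pi) := by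
  rw [Complex.norm_real, Real.norm_of_nonneg (poissonKernelLine_nonneg ht x)]
  exact poissonKernelLine_le ht x

theorem poissonKernelLine_eq (t x : ℝ) : poissonKernelLine t x = t⁻¹ * poissonKernelLine 1 (x / t) := by
  simp [poissonKernelLine]

theorem integrable_poissonKernelLine_one : Integrable (poissonKernelLine 1) := by
  refine (integrable_inv_one_add_sq.const_mul (1 / Real.pi)).congr (Eventually.of_forall fun x => ?_)
  simp [poissonKernelLine]

theorem integrable_poissonKernelLine {t : ℝ} (ht : 0 < t) : Integrable (poissonKernelLine t) := by
  refine ((integrable_poissonKernelLine_one.comp_div ht.ne').const_mul t⁻¹).congr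
    (Eventually.of_forall fun x => ?_)
  exact (poissonKernelLine_eq t x).symm

theorem integral_poissonKernelLine_one : ∫ x, poissonKernelLine 1 x = 1 := by
  have h : ∀ x, poissonKernelLine 1 x = 1 / Real.pi * (1 + x ^ 2)⁻¹ := fun x => by
    simp [poissonKernelLine]
  simp only [h, integral_const_mul, integral_univ_inv_one_add_sq]
  field_simp

/-- The Poisson kernel is an approximate identity. -/
theorem tendsto_integral_poissonKernelLine_mul {U : ℝ → ℂ} (hU : Continuous U)
    (hb : ∃ C : ℝ, ∀ x, ‖U x‖ ≤ C) :
    Tendsto (fun t => ∫ x, (poissonKernelLine t x : ℂ) * U x) (𝓝[>] 0) (𝓝 (U 0)) := by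
  obtain ⟨C, hC⟩ := hb
  have hsub : ∀ t > 0, ∫ x, (poissonKernelLine t x : ℂ) * U x =
      ∫ x, (poissonKernelLine 1 x : ℂ) * U (t * x) := by
    intro t ht
    have h := Measure.integral_comp_div
      (fun x => (t⁻¹ : ℂ) * ((poissonKernelLine 1 x : ℂ) * U (t * x))) t
    rw [integral_const_mul, integral_const_mul, abs_of_pos ht, Complex.real_smul, ← mul_assoc (t : ℂ), mul_inv_cancel₀
      (by exact_mod_cast ht.ne'), one_mul] at h
    rw [← h, ← integral_const_mul]
    refine integral_congr_ae (Eventually.of_forall fun x => ?_)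
    simp only
    rw [poissonKernelLine_eq t x, mul_div_cancel₀ _ ht.ne']
    push_cast
    ring
  have hlim : Tendsto (fun t => ∫ x, (poissonKernelLine 1 x : ℂ) * U (t * x)) (𝓝[>] 0)
      (𝓝 (∫ x, (poissonKernelLine 1 x : ℂ) * U 0)) := by
    refine tendsto_integral_filter_of_dominated_convergence (fun x => poissonKernelLine 1 x * C)
      (Eventually.of_forall fun t => ?_) (Eventually.of_forall fun t => ?_)
      (integrable_poissonKernelLine_one.mul_const C) (Eventually.of_forall fun x => ?_)
    · exact ((Complex.continuous_ofReal.comp (continuous_poissonKernelLine 1)).mul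
        (hU.comp (by fun_prop))).aestronglyMeasurable
    · refine Eventually.of_forall fun x => ?_
      rw [norm_mul, Complex.norm_real, Real.norm_of_nonneg (poissonKernelLine_nonneg one_pos x)]
      exact mul_le_mul_of_nonneg_left (hC _) (poissonKernelLine_nonneg one_pos x)
    · refine Tendsto.const_mul _ ?_
      have hc : Continuous fun t : ℝ => U (t * x) := hU.comp (by fun_prop)
      have := (hc.tendsto 0).mono_left (nhdsWithin_le_nhds (s := Ioi 0))
      simpa using this
  rw [integral_mul_const, integral_complex_ofReal, integral_poissonKernelLine_one] at hlim
  simp only [Complex.ofReal_one, one_mul] at hlim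
  refine hlim.congr' ?_
  filter_upwards [self_mem_nhdsWithin] with t ht
  exact (hsub t ht).symm

/-! ### Hardy space elements are integrable functions -/

theorem continuous_poissonConv (u : 𝓢'(ℝ, ℂ)) (t : ℝ) : Continuous (poissonConv u t) := by
  unfold poissonConv
  split_ifs with h
  · exact h.choose_spec.continuous
  · exact continuous_zero

/-- The supremum is over uncountably many t, but of continuous functions, so it is lower
semicontinuous. -/
theorem measurable_poissonMaximal (u : 𝓢'(ℝ, ℂ)) : Measurable (poissonMaximal u) := by
  have h : LowerSemicontinuous (poissonMaximal u) := by
    unfold poissonMaximal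
    exact lowerSemicontinuous_biSup fun t _ =>
      (continuous_poissonConv u t).enorm.lowerSemicontinuous
  exact h.measurable

theorem isPoissonConv_poissonConv {u : 𝓢'(ℝ, ℂ)} {t : ℝ} (h : ∃ v, IsPoissonConv u t v) :
    IsPoissonConv u t (poissonConv u t) := by
  rw [poissonConv, dif_pos h]
  exact h.choose_spec

theorem enorm_poissonConv_le (u : 𝓢'(ℝ, ℂ)) {t : ℝ} (ht : 0 < t) (x : ℝ) :
    ‖poissonConv u t x‖ₑ ≤ poissonMaximal u x :=
  le_iSup₂ (f := fun (t : ℝ) (_ : 0 < t) => ‖poissonConv u t x‖ₑ) t ht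

/-- A distribution in `H¹` is dominated by its Poisson maximal function. -/
theorem MemHardyH1.enorm_apply_le {u : 𝓢'(ℝ, ℂ)} (hu : MemHardyH1 u) (φ : 𝓢(ℝ, ℂ)) :
    ‖u φ‖ₑ ≤ ∫⁻ x, poissonMaximal u x * ‖φ x‖ₑ := by
  have hcont : Continuous fun x : ℝ => u (φ.compSubConstCLM ℂ (-x)) :=
    (map_continuous u).comp ((SchwartzMap.continuous_compSubConstCLM φ).comp continuous_neg)
  obtain ⟨C, hC⟩ := hu.bounded φ
  -- The pairing of `poissonConv u t` with φ tends to u(φ) as t → 0, by continuity of translation in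
  -- the Schwartz space.
  have hlim := (tendsto_integral_poissonKernelLine_mul hcont ⟨C, fun x => hC (-x)⟩).enorm
  rw [neg_zero, SchwartzMap.compSubConstCLM_zero] at hlim
  refine le_of_tendsto hlim ?_
  filter_upwards [self_mem_nhdsWithin] with t ht
  rw [← (isPoissonConv_poissonConv (hu.poisson t ht)).pairing φ]
  refine (enorm_integral_le_lintegral_enorm _).trans (lintegral_mono fun x => ?_)
  rw [enorm_mul]
  gcongr
  exact enorm_poissonConv_le u ht x

/-- A tempered distribution dominated by an integrable function is an integrable function. -/
theorem exists_isIntegrableRep_of_enorm_apply_le {u : 𝓢'(ℝ, ℂ)} {M : ℝ → ℝ≥0∞}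
    (hM : Measurable M) (hfin : ∫⁻ x, M x < ∞) (h : ∀ φ : 𝓢(ℝ, ℂ), ‖u φ‖ₑ ≤ ∫⁻ x, M x * ‖φ x‖ₑ) :
    ∃ f, IsIntegrableRep u f := by
  -- The bound says that u is continuous for the L¹(μ) norm, hence for L²(μ), as μ is finite.
  -- Schwartz functions are dense there, and Riesz represents u by some g; the density of u is M
  -- times the conjugate of g.
  set μ : Measure ℝ := volume.withDensity M with hμ
  have hae : ∀ᵐ x, M x < ∞ := ae_lt_top hM hfin.ne
  have : IsFiniteMeasure μ := isFiniteMeasure_withDensity hfin.ne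
  have : Fact ((1 : ℝ≥0∞) ≤ 2) := ⟨by norm_num⟩
  set T : 𝓢(ℝ, ℂ) →L[ℂ] Lp ℂ 2 μ := SchwartzMap.toLpCLM ℂ ℂ 2 μ with hT
  have hdense : DenseRange T := SchwartzMap.denseRange_toLpCLM (μ := μ) (p := 2) (by norm_num)
  obtain ⟨K, hK⟩ : ∃ K : ℝ, ∀ φ, ‖u φ‖ ≤ K * ‖T φ‖ := by
    refine ⟨(μ univ ^ (1 / (1 : ℝ≥0∞).toReal - 1 / (2 : ℝ≥0∞).toReal)).toReal, fun φ => ?_⟩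
    have h1 : ‖u φ‖ₑ ≤ eLpNorm φ 1 μ := by
      rw [eLpNorm_one_eq_lintegral_enorm, hμ,
        lintegral_withDensity_eq_lintegral_mul _ hM φ.continuous.measurable.enorm]
      exact h φ
    have h2 := h1.trans (eLpNorm_le_eLpNorm_mul_rpow_measure_univ (p := 1) (q := 2) (by norm_num)
      φ.continuous.aestronglyMeasurable)
    have hne : eLpNorm φ 2 μ * μ univ ^ (1 / (1 : ℝ≥0∞).toReal - 1 / (2 : ℝ≥0∞).toReal) ≠ ∞ := by
      refine ENNReal.mul_ne_top (φ.memLp 2 μ).2.ne (ENNReal.rpow_ne_top_of_nonneg (by norm_num) ?_)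
      exact measure_ne_top _ _
    have h3 := ENNReal.toReal_mono hne h2
    rw [ENNReal.toReal_mul, toReal_enorm, mul_comm] at h3
    rwa [hT, SchwartzMap.toLpCLM_apply, SchwartzMap.norm_toLp]
  have hext := LinearMap.extendOfNorm_eq (f := (u : 𝓢(ℝ, ℂ) →ₗ[ℂ] ℂ)) (e := (T : 𝓢(ℝ, ℂ) →ₗ[ℂ] Lp ℂ 2 μ))
    hdense ⟨K, hK⟩
  set E := (u : 𝓢(ℝ, ℂ) →ₗ[ℂ] ℂ).extendOfNorm (T : 𝓢(ℝ, ℂ) →ₗ[ℂ] Lp ℂ 2 μ)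
  set g : Lp ℂ 2 μ := (InnerProductSpace.toDual ℂ (Lp ℂ 2 μ)).symm E with hg
  refine ⟨fun x => (M x).toReal • starRingEnd ℂ (g x), ?_, fun φ => ?_⟩
  · rw [← integrable_withDensity_iff_integrable_smul' hM hae]
    exact (Complex.conjCLE : ℂ →L[ℝ] ℂ).integrable_comp ((Lp.memLp g).integrable (by norm_num))
  · have h1 : u φ = inner ℂ g (T φ) := by
      rw [hg, InnerProductSpace.toDual_symm_apply]
      exact (hext φ).symm
    rw [h1, L2.inner_def]
    have h2 : ∫ x, inner ℂ (g x) (T φ x) ∂μ = ∫ x, φ x * starRingEnd ℂ (g x) ∂μ := by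
      refine integral_congr_ae ?_
      filter_upwards [φ.coeFn_toLp 2 μ] with x hx
      rw [hT, SchwartzMap.toLpCLM_apply, hx]
      rfl
    rw [h2]
    refine (integral_withDensity_eq_integral_toReal_smul hM hae _).trans ?_
    refine integral_congr_ae (Eventually.of_forall fun x => ?_)
    simp only [Complex.real_smul]
    ring

theorem MemHardyH1.exists_isIntegrableRep {u : 𝓢'(ℝ, ℂ)} (hu : MemHardyH1 u) :
    ∃ f, IsIntegrableRep u f :=
  exists_isIntegrableRep_of_enorm_apply_le (measurable_poissonMaximal u) hu.maximal
    hu.enorm_apply_le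

/-! ### Integrable functions as bounded distributions -/

theorem exists_isIntegrableRep {f : ℝ → ℂ} (hf : Integrable f) :
    ∃ w : 𝓢'(ℝ, ℂ), IsIntegrableRep w f := by
  have : Fact ((1 : ℝ≥0∞) ≤ 1) := ⟨le_rfl⟩
  refine ⟨Lp.toTemperedDistribution ((memLp_one_iff_integrable.2 hf).toLp f), hf, fun φ => ?_⟩
  rw [Lp.toTemperedDistribution_apply]
  refine integral_congr_ae ?_
  filter_upwards [(memLp_one_iff_integrable.2 hf).coeFn_toLp] with x hx
  rw [hx, smul_eq_mul, mul_comm]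

theorem IsIntegrableRep.isBoundedDistribution {u : 𝓢'(ℝ, ℂ)} {f : ℝ → ℂ}
    (h : IsIntegrableRep u f) : IsBoundedDistribution u := by
  intro φ
  refine ⟨∫ y, ‖f y‖ * SchwartzMap.seminorm ℂ 0 0 φ, fun x => ?_⟩
  rw [h.pairing]
  refine norm_integral_le_of_norm_le (h.integrable.norm.mul_const _) (Eventually.of_forall fun y => ?_)
  rw [norm_mul]
  exact mul_le_mul_of_nonneg_left (SchwartzMap.norm_le_seminorm ℂ φ _) (norm_nonneg _)

/-- The Poisson integral of an integrable function. -/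
noncomputable def poissonIntegral (f : ℝ → ℂ) (t x : ℝ) : ℂ :=
  ∫ y, (poissonKernelLine t (x - y) : ℂ) * f y

theorem integrable_poissonKernelLine_mul {f : ℝ → ℂ} (hf : Integrable f) {t : ℝ} (ht : 0 < t)
    (x : ℝ) : Integrable fun y => (poissonKernelLine t (x - y) : ℂ) * f y :=
  hf.bdd_mul (Complex.continuous_ofReal.comp ((continuous_poissonKernelLine t).comp
      (by fun_prop))).aestronglyMeasurable
    (Eventually.of_forall fun y => norm_poissonKernelLine_le ht (x - y))

theorem IsIntegrableRep.isPoissonConv {u : 𝓢'(ℝ, ℂ)} {f : ℝ → ℂ} (h : IsIntegrableRep u f)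
    {t : ℝ} (ht : 0 < t) : IsPoissonConv u t (poissonIntegral f t) := by
  have hf := h.integrable
  have hP : Continuous fun x : ℝ => (poissonKernelLine t x : ℂ) :=
    Complex.continuous_ofReal.comp (continuous_poissonKernelLine t)
  have hbound : ∀ x y, ‖(poissonKernelLine t (x - y) : ℂ) * f y‖ ≤ t⁻¹ * (1 / Real.pi) * ‖f y‖ := by
    intro x y
    rw [norm_mul]
    exact mul_le_mul_of_nonneg_right (norm_poissonKernelLine_le ht _) (norm_nonneg _)
  refine ⟨?_, ⟨∫ y, t⁻¹ * (1 / Real.pi) * ‖f y‖, fun x => ?_⟩, fun φ => ?_⟩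
  · refine continuous_of_dominated (bound := fun y => t⁻¹ * (1 / Real.pi) * ‖f y‖)
      (fun x => (integrable_poissonKernelLine_mul hf ht x).aestronglyMeasurable)
      (fun x => Eventually.of_forall (hbound x)) (hf.norm.const_mul _)
      (Eventually.of_forall fun y => ?_)
    exact (hP.comp (by fun_prop)).mul continuous_const
  · exact norm_integral_le_of_norm_le (hf.norm.const_mul _) (Eventually.of_forall (hbound x))
  · have hI1 : Integrable (Function.uncurry fun y z : ℝ =>
        (poissonKernelLine t (y - z) : ℂ) * f z * φ y) (volume.prod volume) := by
      have h1 : Integrable (fun p : ℝ × ℝ => φ p.1 * f p.2) (volume.prod volume) :=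
        φ.integrable.mul_prod hf
      refine (h1.bdd_mul (f := fun p : ℝ × ℝ => (poissonKernelLine t (p.1 - p.2) : ℂ))
        (hP.comp (by fun_prop)).aestronglyMeasurable
        (Eventually.of_forall fun p => norm_poissonKernelLine_le ht _)).congr
        (Eventually.of_forall fun p => ?_)
      simp only [Function.uncurry]
      ring
    have hI2 : Integrable (Function.uncurry fun x z : ℝ =>
        (poissonKernelLine t x : ℂ) * (f z * φ (z + x))) (volume.prod volume) := by
      have h1 : Integrable (fun p : ℝ × ℝ => (poissonKernelLine t p.1 : ℂ) * f p.2)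
          (volume.prod volume) := (integrable_poissonKernelLine ht).ofReal.mul_prod hf
      refine (h1.bdd_mul (f := fun p : ℝ × ℝ => φ (p.2 + p.1))
        (φ.continuous.comp (by fun_prop)).aestronglyMeasurable
        (Eventually.of_forall fun p => SchwartzMap.norm_le_seminorm ℂ φ _)).congr
        (Eventually.of_forall fun p => ?_)
      simp only [Function.uncurry]
      ring
    calc ∫ y, poissonIntegral f t y * φ y
        = ∫ y, ∫ z, (poissonKernelLine t (y - z) : ℂ) * f z * φ y := by
          simp only [poissonIntegral, integral_mul_const]
      _ = ∫ z, ∫ y, (poissonKernelLine t (y - z) : ℂ) * f z * φ y := integral_integral_swap hI1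
      _ = ∫ z, ∫ x, (poissonKernelLine t x : ℂ) * (f z * φ (z + x)) := by
          refine integral_congr_ae (Eventually.of_forall fun z => ?_)
          simp only
          rw [← integral_sub_right_eq_self
            (fun x => (poissonKernelLine t x : ℂ) * (f z * φ (z + x))) z]
          refine integral_congr_ae (Eventually.of_forall fun y => ?_)
          simp only [add_sub_cancel]
          ring
      _ = ∫ x, ∫ z, (poissonKernelLine t x : ℂ) * (f z * φ (z + x)) :=
          (integral_integral_swap hI2).symm
      _ = ∫ x, (poissonKernelLine t x : ℂ) * u (φ.compSubConstCLM ℂ (-x)) := by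
          refine integral_congr_ae (Eventually.of_forall fun x => ?_)
          simp only [h.pairing, integral_const_mul, SchwartzMap.compSubConstCLM_apply, sub_neg_eq_add]

/-- Smooth compactly supported test functions determine v almost everywhere, and continuity does the
rest. This identifies the choice in `poissonConv` with the Poisson integral. -/
theorem IsPoissonConv.unique {u : 𝓢'(ℝ, ℂ)} {t : ℝ} {v w : ℝ → ℂ} (hv : IsPoissonConv u t v)
    (hw : IsPoissonConv u t w) : v = w := by
  refine Measure.eq_of_ae_eq (μ := (volume : Measure ℝ)) ?_ hv.continuous hw.continuous
  refine ae_eq_of_integral_contDiff_smul_eq hv.continuous.locallyIntegrable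
    hw.continuous.locallyIntegrable fun g hg hgc => ?_
  have h1 : HasCompactSupport fun x => (g x : ℂ) := hgc.comp_left Complex.ofReal_zero
  have h2 : ContDiff ℝ (⊤ : ℕ∞) fun x => (g x : ℂ) := Complex.ofRealCLM.contDiff.comp hg
  have h3 := (hv.pairing (h1.toSchwartzMap h2)).trans (hw.pairing (h1.toSchwartzMap h2)).symm
  simp only [HasCompactSupport.toSchwartzMap_toFun] at h3
  simpa only [Complex.real_smul, mul_comm] using h3

theorem IsIntegrableRep.poissonConv_eq {u : 𝓢'(ℝ, ℂ)} {f : ℝ → ℂ} (h : IsIntegrableRep u f)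
    {t : ℝ} (ht : 0 < t) : poissonConv u t = poissonIntegral f t :=
  (isPoissonConv_poissonConv ⟨_, h.isPoissonConv ht⟩).unique (h.isPoissonConv ht)

/-! ### Averages of dilations -/

theorem ae_comp_mul_left {p : ℝ → Prop} (hp : ∀ᵐ y, p y) {x : ℝ} (hx : x ≠ 0) :
    ∀ᵐ σ, p (x * σ) := by
  have h : Measure.QuasiMeasurePreserving (fun σ : ℝ => x * σ) volume volume :=
    ⟨measurable_const_mul x, by
      rw [Real.map_volume_mul_left hx]
      exact Measure.smul_absolutelyContinuous⟩
  exact h.ae hp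

theorem lintegral_comp_mul_right {M : ℝ → ℝ≥0∞} (hM : Measurable M) {σ : ℝ} (hσ : 0 < σ) :
    ∫⁻ x, M (x * σ) = ENNReal.ofReal σ⁻¹ * ∫⁻ x, M x := by
  rw [← lintegral_map (f := M) (g := fun x => x * σ) hM (measurable_mul_const σ),
    Real.map_volume_mul_right hσ.ne', lintegral_smul_measure, smul_eq_mul,
    abs_of_pos (inv_pos.2 hσ)]

theorem aestronglyMeasurable_of_integrableOn_div {K : ℝ → ℂ}
    (hK : IntegrableOn (fun σ => K σ / (σ : ℂ)) (Ioo 0 1)) :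
    AEStronglyMeasurable K (volume.restrict (Ioo 0 1)) := by
  refine (hK.aestronglyMeasurable.mul
    Complex.measurable_ofReal.aestronglyMeasurable).congr ?_
  filter_upwards [ae_restrict_mem measurableSet_Ioo] with σ hσ
  have : (σ : ℂ) ≠ 0 := by exact_mod_cast hσ.1.ne'
  simp only [Pi.mul_apply]
  field_simp

/-- Tonelli with x first: the L¹ norm of g(·σ) is that of g divided by σ. Strong measurability of g
makes the composition with (x, σ) ↦ xσ measurable. -/
theorem integrable_prod_dilation {K : ℝ → ℂ}
    (hK : IntegrableOn (fun σ => K σ / (σ : ℂ)) (Ioo 0 1)) {g : ℝ → ℂ} (hgm : StronglyMeasurable g)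
    (hg : Integrable g) :
    Integrable (fun p : ℝ × ℝ => K p.2 * g (p.1 * p.2))
      ((volume : Measure ℝ).prod (volume.restrict (Ioo 0 1))) := by
  have hm : AEStronglyMeasurable (fun p : ℝ × ℝ => K p.2 * g (p.1 * p.2))
      ((volume : Measure ℝ).prod (volume.restrict (Ioo 0 1))) :=
    (aestronglyMeasurable_of_integrableOn_div hK).comp_snd.mul
      (hgm.comp_measurable (measurable_fst.mul measurable_snd)).aestronglyMeasurable
  rw [integrable_prod_iff' hm]
  refine ⟨?_, (hK.norm.mul_const (∫ x, ‖g x‖)).congr ?_⟩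
  · filter_upwards [ae_restrict_mem measurableSet_Ioo] with σ hσ
    exact (hg.comp_mul_right' hσ.1.ne').const_mul _
  · filter_upwards [ae_restrict_mem measurableSet_Ioo] with σ hσ
    simp only [norm_mul, integral_const_mul]
    rw [Measure.integral_comp_mul_right (fun x => ‖g x‖) σ, abs_of_pos (inv_pos.2 hσ.1),
      norm_div, Complex.norm_real, Real.norm_of_nonneg hσ.1.le, smul_eq_mul]
    ring

theorem poissonKernelLine_sub_div {t σ : ℝ} (hσ : 0 < σ) (x z : ℝ) :
    poissonKernelLine t (x - z / σ) = σ * poissonKernelLine (t * σ) (x * σ - z) := by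
  unfold poissonKernelLine
  have h1 : (x * σ - z) / (t * σ) = (x - z / σ) / t := by
    rw [mul_comm t σ, ← div_div]
    congr 1
    field_simp
  rw [h1, mul_inv]
  field_simp

/-- Dilation covariance of the Poisson integral, the fact that makes the maximal function commute
with dilations. -/
theorem integral_poissonKernelLine_mul_comp_mul (f : ℝ → ℂ) {t σ : ℝ} (hσ : 0 < σ) (x : ℝ) :
    ∫ y, (poissonKernelLine t (x - y) : ℂ) * f (y * σ) = poissonIntegral f (t * σ) (x * σ) := by
  have h := Measure.integral_comp_mul_right
    (fun z => (poissonKernelLine t (x - z / σ) : ℂ) * f z) σ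
  simp only [mul_div_cancel_right₀ _ hσ.ne'] at h
  rw [h, poissonIntegral, ← integral_smul]
  refine integral_congr_ae (Eventually.of_forall fun z => ?_)
  simp only [poissonKernelLine_sub_div hσ, abs_of_pos (inv_pos.2 hσ), Complex.real_smul]
  have : (σ : ℂ) ≠ 0 := by exact_mod_cast hσ.ne'
  push_cast
  field_simp

/-- Averages of dilations with a kernel `K` such that `K(σ) / σ` is integrable act on `L¹`. -/
theorem dilation_average_integrable {K : ℝ → ℂ}
    (hK : IntegrableOn (fun σ => K σ / (σ : ℂ)) (Ioo 0 1)) {f : ℝ → ℂ} (hf : Integrable f) :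
    (∀ᵐ x : ℝ, IntegrableOn (fun σ => K σ * f (x * σ)) (Ioo 0 1)) ∧
      Integrable (fun x => ∫ σ in Ioo (0 : ℝ) 1, K σ * f (x * σ)) ∧
      ∀ t > 0, ∀ x, poissonIntegral (fun x => ∫ σ in Ioo (0 : ℝ) 1, K σ * f (x * σ)) t x =
        ∫ σ in Ioo (0 : ℝ) 1, K σ * poissonIntegral f (t * σ) (x * σ) := by
  obtain ⟨g, hgm, hfg⟩ := hf.1
  have hg : Integrable g := hf.congr hfg
  have hprod := integrable_prod_dilation hK hgm hg
  -- At x = 0 all points xσ coincide, so f and its representative g could differ for every σ.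
  have hx0 : ∀ᵐ x : ℝ, x ≠ 0 := by simp [ae_iff, measure_singleton]
  have hcongr : ∀ᵐ x : ℝ, (fun σ => K σ * g (x * σ)) =ᵐ[volume.restrict (Ioo 0 1)]
      fun σ => K σ * f (x * σ) := by
    filter_upwards [hx0] with x hx
    filter_upwards [ae_restrict_of_ae (ae_comp_mul_left hfg hx)] with σ hσ
    rw [hσ]
  have hmean : (fun x => ∫ σ in Ioo (0 : ℝ) 1, K σ * g (x * σ)) =ᵐ[volume]
      fun x => ∫ σ in Ioo (0 : ℝ) 1, K σ * f (x * σ) := by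
    filter_upwards [hcongr] with x hx
    exact integral_congr_ae hx
  refine ⟨?_, hprod.integral_prod_left.congr hmean, fun t ht x => ?_⟩
  · filter_upwards [hprod.prod_right_ae, hcongr] with x h1 h2
    exact h1.congr h2
  · have hpg : ∀ s y, poissonIntegral f s y = poissonIntegral g s y := fun s y => by
      refine integral_congr_ae ?_
      filter_upwards [hfg] with z hz
      rw [hz]
    have hP : Continuous fun y : ℝ => (poissonKernelLine t (x - y) : ℂ) :=
      Complex.continuous_ofReal.comp ((continuous_poissonKernelLine t).comp (by fun_prop))
    have hI : Integrable (Function.uncurry fun y σ : ℝ =>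
        (poissonKernelLine t (x - y) : ℂ) * (K σ * g (y * σ)))
        ((volume : Measure ℝ).prod (volume.restrict (Ioo 0 1))) :=
      hprod.bdd_mul (f := fun p : ℝ × ℝ => (poissonKernelLine t (x - p.1) : ℂ))
        (hP.comp continuous_fst).aestronglyMeasurable
        (Eventually.of_forall fun p => norm_poissonKernelLine_le ht _)
    calc poissonIntegral (fun x => ∫ σ in Ioo (0 : ℝ) 1, K σ * f (x * σ)) t x
        = ∫ y, ∫ σ in Ioo (0 : ℝ) 1, (poissonKernelLine t (x - y) : ℂ) * (K σ * g (y * σ)) := by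
          rw [poissonIntegral]
          refine integral_congr_ae ?_
          filter_upwards [hmean] with y hy
          rw [← hy, integral_const_mul]
      _ = ∫ σ in Ioo (0 : ℝ) 1, ∫ y, (poissonKernelLine t (x - y) : ℂ) * (K σ * g (y * σ)) :=
          integral_integral_swap hI
      _ = ∫ σ in Ioo (0 : ℝ) 1, K σ * poissonIntegral f (t * σ) (x * σ) := by
          refine setIntegral_congr_fun measurableSet_Ioo fun σ hσ => ?_
          rw [hpg, ← integral_poissonKernelLine_mul_comp_mul g hσ.1, ← integral_const_mul]
          refine integral_congr_ae (Eventually.of_forall fun y => ?_)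
          ring

/-- Averages of dilations with a kernel `K` such that `K(σ) / σ` is integrable act on `H¹`. -/
theorem exists_memHardyH1_dilation_average {K : ℝ → ℂ}
    (hK : IntegrableOn (fun σ => K σ / (σ : ℂ)) (Ioo 0 1)) {u : 𝓢'(ℝ, ℂ)} (hu : MemHardyH1 u)
    {f : ℝ → ℂ} (hf : IsIntegrableRep u f) :
    ∃ w : 𝓢'(ℝ, ℂ), IsIntegrableRep w (fun x => ∫ σ in Ioo (0 : ℝ) 1, K σ * f (x * σ)) ∧
      MemHardyH1 w ∧
      hardyNorm w ≤ ENNReal.ofReal (∫ σ in Ioo (0 : ℝ) 1, ‖K σ‖ / σ) * hardyNorm u := by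
  obtain ⟨-, hint, hpoisson⟩ := dilation_average_integrable hK hf.integrable
  obtain ⟨w, hw⟩ := exists_isIntegrableRep hint
  have hMm := measurable_poissonMaximal u
  -- The bound is uniform in t because every height tσ is already admitted in the supremum defining
  -- `poissonMaximal u`.
  have hmax : ∀ x, poissonMaximal w x ≤
      ∫⁻ σ in Ioo (0 : ℝ) 1, ‖K σ‖ₑ * poissonMaximal u (x * σ) := by
    intro x
    refine iSup₂_le fun t ht => ?_
    rw [hw.poissonConv_eq ht, hpoisson t ht]
    refine (enorm_integral_le_lintegral_enorm _).trans
      (setLIntegral_mono' measurableSet_Ioo fun σ hσ => ?_)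
    rw [enorm_mul, ← hf.poissonConv_eq (mul_pos ht hσ.1)]
    gcongr
    exact enorm_poissonConv_le u (mul_pos ht hσ.1) _
  have hnorm : hardyNorm w ≤
      ENNReal.ofReal (∫ σ in Ioo (0 : ℝ) 1, ‖K σ‖ / σ) * hardyNorm u := by
    calc hardyNorm w ≤ ∫⁻ x, ∫⁻ σ in Ioo (0 : ℝ) 1, ‖K σ‖ₑ * poissonMaximal u (x * σ) :=
          lintegral_mono hmax
      _ = ∫⁻ σ in Ioo (0 : ℝ) 1, ∫⁻ x, ‖K σ‖ₑ * poissonMaximal u (x * σ) := by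
          refine lintegral_lintegral_swap ?_
          exact (aestronglyMeasurable_of_integrableOn_div hK).comp_snd.enorm.mul
            (hMm.comp (measurable_fst.mul measurable_snd)).aemeasurable
      _ = ∫⁻ σ in Ioo (0 : ℝ) 1, ‖K σ / (σ : ℂ)‖ₑ * hardyNorm u := by
          refine setLIntegral_congr_fun measurableSet_Ioo fun σ hσ => ?_
          have hMσ : Measurable fun x => poissonMaximal u (x * σ) :=
            hMm.comp (measurable_mul_const σ)
          rw [lintegral_const_mul _ hMσ, lintegral_comp_mul_right hMm hσ.1, ← mul_assoc, div_eq_mul_inv, enorm_mul,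
            ← Complex.ofReal_inv, hardyNorm]
          congr 2
          rw [← ofReal_norm, Complex.norm_real, Real.norm_of_nonneg (inv_pos.2 hσ.1).le]
      _ = (∫⁻ σ in Ioo (0 : ℝ) 1, ‖K σ / (σ : ℂ)‖ₑ) * hardyNorm u :=
          lintegral_mul_const' _ _ hu.maximal.ne
      _ = _ := by
          congr 1
          rw [← ofReal_integral_norm_eq_lintegral_enorm hK]
          congr 1
          refine setIntegral_congr_fun measurableSet_Ioo fun σ hσ => ?_
          simp only [norm_div, Complex.norm_real, Real.norm_of_nonneg hσ.1.le]
  exact ⟨w, hw, ⟨hw.isBoundedDistribution, fun t ht => ⟨_, hw.isPoissonConv ht⟩,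
    hnorm.trans_lt (ENNReal.mul_lt_top ENNReal.ofReal_lt_top hu.maximal)⟩, hnorm⟩

/-! ### The Galué kernel and the main theorem -/

/-- Condition 3 is bₖ > 0, that is, poles in the open left half plane; conditions 1 and 2 give ∑a -
∑b = ∑δ > 0. The radius R need not be 1, so integrability on all of (0, ∞) is restricted to (0, 1).
-/
theorem integrableOn_galueKernel_div {m : ℕ} {β lam δ γ : Fin m → ℝ} (hβ : ∀ k, 0 < β k)
    (hlam : ∀ k, 0 < lam k) (h₁ : ∑ k, 1 / lam k = ∑ k, 1 / β k) (h₂ : 0 < ∑ k, δ k)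
    (h₃ : ∀ k, 1 < (γ k + 1) * lam k)
    (L : LeftLoop (fun k => γ k + 1 - 1 / lam k) (fun k => 1 / lam k)) :
    IntegrableOn (fun σ : ℝ => galueKernel β lam γ δ L σ / (σ : ℂ)) (Ioo 0 1) := by
  refine (integrableOn_foxH_div (fun k => one_div_pos.2 (hβ k)) (fun k => one_div_pos.2 (hlam k))
    h₁.symm ?_ (fun k => ?_) L).mono_set fun σ hσ => hσ.1
  · simp only [Finset.sum_sub_distrib, Finset.sum_add_distrib, h₁]
    linarith
  · have := h₃ k
    rw [← div_lt_iff₀ (hlam k)] at this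
    linarith

theorem mainTheorem1 (m : ℕ) (hm : 1 ≤ m) (β lam δ γ : Fin m → ℝ)
    (hβ : ∀ k, 0 < β k) (hlam : ∀ k, 0 < lam k) (hδ : ∀ k, 0 ≤ δ k)
    (h₁ : ∑ k, 1 / lam k = ∑ k, 1 / β k)
    (h₂ : 0 < ∑ k, δ k)
    (h₃ : ∀ k, 1 < (γ k + 1) * lam k)
    (L : LeftLoop (fun k => γ k + 1 - 1 / lam k) (fun k => 1 / lam k)) :
    -- the constant is finite
    IntegrableOn (fun σ : ℝ => ‖galueKernel β lam γ δ L σ‖ / σ) (Ioo 0 1) ∧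
    ∀ u : 𝓢'(ℝ, ℂ), MemHardyH1 u →
      -- `u` is an integrable function `f`, unique up to null sets
      (∃ f : ℝ → ℂ, IsIntegrableRep u f) ∧
      ∀ f : ℝ → ℂ, IsIntegrableRep u f →
        -- the integral that defines the operator converges absolutely at almost every point
        (∀ᵐ x : ℝ, IntegrableOn (fun σ : ℝ => galueKernel β lam γ δ L σ * f (x * σ)) (Ioo 0 1)) ∧
        -- the image of `f` is in the Hardy space, with the norm bound
        ∃ w : 𝓢'(ℝ, ℂ), IsIntegrableRep w (galueOperator β lam γ δ L f) ∧ MemHardyH1 w ∧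
          hardyNorm w ≤ ENNReal.ofReal (galueConst β lam γ δ L) * hardyNorm u := by
  have hK := integrableOn_galueKernel_div hβ hlam h₁ h₂ h₃ L
  refine ⟨IntegrableOn.congr_fun hK.norm (fun σ hσ => ?_) measurableSet_Ioo, fun u hu =>
    ⟨hu.exists_isIntegrableRep, fun f hf => ⟨(dilation_average_integrable hK hf.integrable).1,
      exists_memHardyH1_dilation_average hK hu hf⟩⟩⟩
  simp only [norm_div, Complex.norm_real, Real.norm_of_nonneg hσ.1.le]
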